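/- Let $\mathfrak h$ be a vector space over $\mathbb C$ with a nondegenerate bilinear form $(\cdot,\cdot)$, let $\hat{\mathfrak h}=\mathfrak h\otimes\mathbb C[t,t^{-1}]\oplus\mathbb C\mathbf k$ and $\hat{\mathfrak h}_-=\mathfrak h\otimes t^{-1}\mathbb C[t^{-1}]$. Let $N(\hat{\mathfrak h})$ be the quotient of the tensor algebra $T(\hat{\mathfrak h})$ by the relations $$(a\otimes t^m)(b\otimes t^n)-(b\otimes t^n)(a\otimes t^m)=m(a,b)\delta_{m+n,0}\mathbf k,\quad [a\otimes t^k,b\otimes t^0]=0,\quad [a\otimes t^k,\mathbf k]=0$$ for $a,b\in\mathfrak h$, $m>0$, $n<0$, $k\in\mathbb Z$. The tensor algebra $V=T(\hat{\mathfrak h}_-)$ is a left $N(\hat{\mathfrak h})$-module in which $\mathbf k$ acts as $1$, and the operators $a(n)$ (the action of $a\otimes t^n$) satisfy: $a(n)$ is left multiplication by $a\otimes t^{n}$ for $n<0$, $a(0)=0$, and $a(n)\mathbf 1=0$ for $n>0$, where $\mathbf 1=1\in V$. Put $a(x)=\sum_{n\in\mathbb Z}a(n)x^{-n-1}$. The normally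 ordered product ${:}a_1(n_1)\cdots a_k(n_k){:}$ is the product of the same operators in which those with $n_i<0$ come first, then those with $n_i>0$, then those with $n_i=0$, the order inside each of these three groups being kept. Let $V_{(n)}$ be the span of the elements $a_1(-m_1)\cdots a_k(-m_k)\mathbf 1$ with $k\ge 0$, $a_i\in\mathfrak h$, $m_i\ge 1$ and $m_1+\dots+m_k=n$, and let $Y:V\to(\operatorname{End}V)[[x,x^{-1}]]$ be the linear map with $$Y(a_1(-m_1)\cdots a_k(-m_k)\mathbf 1,x)={:}\Bigl(\tfrac1{(m_1-1)!}\tfrac{d^{m_1-1}}{dx^{m_1-1}}a_1(x)\Bigr)\cdots\Bigl(\tfrac1{(m_k-1)!}\tfrac{d^{m_k-1}}{dx^{m_k-1}}a_k(x)\Bigr){:}\,.$$ Then $(V,Y,\mathbf 1)$ is a meromorphic open-string vertex algebra. That is, $V=\coprod_{n\in\mathbb Z}V_{(n)}$ and, with $V'=\coprod_n V_{(n)}^*$ the graded dual, the following hold. 1. Lower bound: $V_{(n)}=0$ for $n$ sufficiently negative. 2. Identity and creation: $Y(\mathbf 1,x)=1_V$; and for $u\in V$, $Y(u,x)\mathbf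 1\in V[[x]]$ has constant term $u$. 3. Rationality: for $u_1,\dots,u_n,v\in V$ and $v'\in V'$, the series $\langle v',Y(u_1,z_1)\cdots Y(u_n,z_n)v\rangle$ converges absolutely for $|z_1|>\cdots>|z_n|>0$ to a rational function in $z_1,\dots,z_n$ whose only possible poles are at $z_i=0$ and at $z_i=z_j$ ($i\neq j$); and for $u_1,u_2,v\in V$, $v'\in V'$, the series $\langle v',Y(Y(u_1,z_1-z_2)u_2,z_2)v\rangle$ converges absolutely for $|z_2|>|z_1-z_2|>0$ to a rational function whose only possible poles are at $z_1=0$, $z_2=0$ and $z_1=z_2$. 4. Associativity: for $u_1,u_2,v\in V$ and $v'\in V'$, one has $\langle v',Y(u_1,z_1)Y(u_2,z_2)v\rangle=\langle v',Y(Y(u_1,z_1-z_2)u_2,z_2)v\rangle$ when $|z_1|>|z_2|>|z_1-z_2|>0$. 5. $\mathbf d$-bracket property: if $\mathbf d$ acts on $V_{(n)}$ as multiplication by $n$, then $[\mathbf d,Y(u,x)]=Y(\mathbf d u,x)+x\frac{d}{dx}Y(u,x)$ for $u\in V$. 6. $D$-derivative property and $D$-commutator formula: if $Du=\lim_{x\to0}\frac{d}{dx}Y(u,x)\mathbf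 1$, then $\frac{d}{dx}Y(u,x)=Y(Du,x)=[D,Y(u,x)]$ for $u\in V$. If moreover $\mathfrak h$ is finite dimensional, then $(V,Y,\mathbf 1)$ is grading-restricted: $\dim V_{(n)}<\infty$ for every $n\in\mathbb Z$. -/

import Mathlib

open Module

namespace Mosva

/-! ### Meromorphic open-string vertex algebras -/

section General

/-- Formal distributions `E[[x, x⁻¹]]`, infinite in both directions: `f n` is the coefficient
of `x ^ n`. -/
abbrev FormalDist (E : Type*) : Type _ := ℤ → E

/-- The formal derivative `d/dx` on `E[[x, x⁻¹]]`. -/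
def FormalDist.deriv {E : Type*} [AddCommGroup E] (f : FormalDist E) : FormalDist E :=
  fun n => (n + 1) • f (n + 1)

/-- The operator `x d/dx` on `E[[x, x⁻¹]]`. -/
def FormalDist.xDeriv {E : Type*} [AddCommGroup E] (f : FormalDist E) : FormalDist E :=
  fun n => n • f n

/-- The series `∑ i, f i` of complex numbers converges absolutely, with sum `s`. -/
def ConvergesAbsolutelyTo {ι : Type*} (f : ι → ℂ) (s : ℂ) : Prop :=
  Summable (fun i => ‖f i‖) ∧ HasSum f s

variable {V : Type*} [AddCommGroup V] [Module ℂ V]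

/-- The graded dual `V' = ∐ₙ (V₍ₙ₎)*` inside the full dual: the linear functionals vanishing on
all but finitely many homogeneous subspaces. -/
def IsGradedDual (gr : ℤ → Submodule ℂ V) (φ : Dual ℂ V) : Prop :=
  {n : ℤ | ∃ v ∈ gr n, φ v ≠ 0}.Finite

/-- The grading operator `d` of `V = ∐ₙ V₍ₙ₎`: it acts on `V₍ₙ₎` as multiplication by `n`. -/
noncomputable def gradingOperator (gr : ℤ → Submodule ℂ V) (h : DirectSum.IsInternal gr) :
    End ℂ V :=
  DirectSum.toModule ℂ ℤ V (fun n => (n : ℂ) • (gr n).subtype) ∘ₗ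
    (LinearEquiv.ofBijective (DirectSum.coeLinearMap gr) h).symm.toLinearMap

/-- The operator `D`, which sends `u` to the value at `x = 0` (that is, the constant term) of
`d/dx Y(u, x)𝟏`. -/
def translationOperator (Y : V →ₗ[ℂ] FormalDist (End ℂ V)) (one : V) : V → V :=
  fun u => FormalDist.deriv (Y u) 0 one

/-- The terms of the series `⟨φ, Y(u₁, z₁) ⋯ Y(uₙ, zₙ) v⟩`, indexed by the exponents of
`z₁, …, zₙ`. -/
noncomputable def productTerm (Y : V →ₗ[ℂ] FormalDist (End ℂ V)) {n : ℕ} (u : Fin n → V) (v : V)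
    (φ : Dual ℂ V) (z : Fin n → ℂ) (e : Fin n → ℤ) : ℂ :=
  φ ((List.ofFn fun i => Y (u i) (e i)).prod v) * ∏ i, z i ^ e i

/-- The terms of the series `⟨φ, Y(Y(u₁, z₁ - z₂)u₂, z₂) v⟩`, indexed by the exponents of
`z₁ - z₂` and `z₂`. -/
noncomputable def iterateTerm (Y : V →ₗ[ℂ] FormalDist (End ℂ V)) (u₁ u₂ v : V)
    (φ : Dual ℂ V) (z₁ z₂ : ℂ) (e : ℤ × ℤ) : ℂ :=
  φ (Y (Y u₁ e.1 u₂) e.2 v) * (z₁ - z₂) ^ e.1 * z₂ ^ e.2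

/-- `(V, Y, 𝟏)` is a meromorphic open-string vertex algebra, where `V` is graded by the
subspaces `gr n = V₍ₙ₎`, `n ∈ ℤ`, and `Y(u, x) = ∑ₙ (Y u n) xⁿ`. -/
structure IsMeromorphicOpenStringVertexAlgebra (gr : ℤ → Submodule ℂ V)
    (Y : V →ₗ[ℂ] FormalDist (End ℂ V)) (one : V) : Prop where
  /-- `V = ∐ₙ V₍ₙ₎`. -/
  isInternal : DirectSum.IsInternal gr
  lower_bound : ∃ N : ℤ, ∀ n < N, gr n = ⊥
  /-- `Y(𝟏, x) = 1`. -/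
  identity : ∀ n : ℤ, Y one n = if n = 0 then 1 else 0
  /-- `Y(u, x)𝟏 ∈ V[[x]]`. -/
  creation_regular : ∀ (u : V) (n : ℤ), n < 0 → Y u n one = 0
  /-- The value of `Y(u, x)𝟏` at `x = 0` is `u`. -/
  creation : ∀ u : V, Y u 0 one = u
  /-- Products converge absolutely in `|z₁| > ⋯ > |zₙ| > 0` to a rational function whose only
  possible poles are at `zᵢ = 0` and `zᵢ = zⱼ`. -/
  rationality_product : ∀ (n : ℕ) (u : Fin n → V) (v : V) (φ : Dual ℂ V), IsGradedDual gr φ →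
    ∃ (p : MvPolynomial (Fin n) ℂ) (N : ℕ), ∀ z : Fin n → ℂ,
      StrictAnti (fun i => ‖z i‖) → (∀ i, z i ≠ 0) →
      ConvergesAbsolutelyTo (productTerm Y u v φ z)
        (MvPolynomial.eval z p / ((∏ i, z i) * ∏ i, ∏ j ∈ Finset.Ioi i, (z i - z j)) ^ N)
  /-- Iterates converge absolutely in `|z₂| > |z₁ - z₂| > 0` to a rational function whose only
  possible poles are at `z₁ = 0`, `z₂ = 0` and `z₁ = z₂`. -/
  rationality_iterate : ∀ (u₁ u₂ v : V) (φ : Dual ℂ V), IsGradedDual gr φ →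
    ∃ (p : MvPolynomial (Fin 2) ℂ) (N : ℕ), ∀ z₁ z₂ : ℂ, 0 < ‖z₁ - z₂‖ → ‖z₁ - z₂‖ < ‖z₂‖ →
      ConvergesAbsolutelyTo (iterateTerm Y u₁ u₂ v φ z₁ z₂)
        (MvPolynomial.eval ![z₁, z₂] p / (z₁ * z₂ * (z₁ - z₂)) ^ N)
  /-- Products and iterates have the same sum in `|z₁| > |z₂| > |z₁ - z₂| > 0`. -/
  associativity : ∀ (u₁ u₂ v : V) (φ : Dual ℂ V), IsGradedDual gr φ →
    ∀ z₁ z₂ : ℂ, ‖z₂‖ < ‖z₁‖ → ‖z₁ - z₂‖ < ‖z₂‖ → 0 < ‖z₁ - z₂‖ →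
      ∃ s : ℂ, ConvergesAbsolutelyTo (productTerm Y ![u₁, u₂] v φ ![z₁, z₂]) s ∧
        ConvergesAbsolutelyTo (iterateTerm Y u₁ u₂ v φ z₁ z₂) s
  /-- `[d, Y(u, x)] = Y(d u, x) + x d/dx Y(u, x)`. -/
  d_bracket : ∀ (u : V) (n : ℤ), ⁅gradingOperator gr isInternal, Y u n⁆ =
    Y (gradingOperator gr isInternal u) n + FormalDist.xDeriv (Y u) n
  /-- `d/dx Y(u, x) = Y(D u, x)`. -/
  D_derivative : ∀ u : V, FormalDist.deriv (Y u) = Y (translationOperator Y one u)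
  /-- `d/dx Y(u, x) = [D, Y(u, x)]`. -/
  D_commutator : ∀ (u : V) (n : ℤ) (v : V), FormalDist.deriv (Y u) n v =
    translationOperator Y one (Y u n v) - Y u n (translationOperator Y one v)

/-- The grading-restriction condition: all homogeneous subspaces are finite dimensional. -/
def IsGradingRestricted (gr : ℤ → Submodule ℂ V) : Prop :=
  ∀ n : ℤ, FiniteDimensional ℂ (gr n)

end General

/-! ### The affinization `ĥ`, the algebra `N(ĥ)` and its module `T(ĥ₋)` -/

section Construction

variable {h : Type*} [AddCommGroup h] [Module ℂ h]

variable (h) in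
/-- The affinization `ĥ = h ⊗ ℂ[t, t⁻¹] ⊕ ℂ𝐤`; the first summand is written as the space of
Laurent polynomials with coefficients in `h`. -/
abbrev Affinization : Type _ := (ℤ →₀ h) × ℂ

/-- The element `a ⊗ tⁿ` of `ĥ`. -/
noncomputable def tpow (n : ℤ) : h →ₗ[ℂ] Affinization h :=
  LinearMap.inl ℂ _ _ ∘ₗ Finsupp.lsingle n

variable (h) in
/-- The element `𝐤` of `ĥ`. -/
def centralElement : Affinization h := (0, 1)

/-- The relations defining `N(ĥ)` as a quotient of the tensor algebra `T(ĥ)`. -/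
inductive NRel (B : LinearMap.BilinForm ℂ h) :
    TensorAlgebra ℂ (Affinization h) → TensorAlgebra ℂ (Affinization h) → Prop
  | pos_neg (a b : h) (m n : ℤ) (hm : 0 < m) (hn : n < 0) :
      NRel B
        (TensorAlgebra.ι ℂ (tpow m a) * TensorAlgebra.ι ℂ (tpow n b))
        (TensorAlgebra.ι ℂ (tpow n b) * TensorAlgebra.ι ℂ (tpow m a) +
          (if m + n = 0 then (m : ℂ) * B a b else 0) • TensorAlgebra.ι ℂ (centralElement h))
  | zero (a b : h) (k : ℤ) :
      NRel B
        (TensorAlgebra.ι ℂ (tpow k a) * TensorAlgebra.ι ℂ (tpow 0 b))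
        (TensorAlgebra.ι ℂ (tpow 0 b) * TensorAlgebra.ι ℂ (tpow k a))
  | central (a : h) (k : ℤ) :
      NRel B
        (TensorAlgebra.ι ℂ (tpow k a) * TensorAlgebra.ι ℂ (centralElement h))
        (TensorAlgebra.ι ℂ (centralElement h) * TensorAlgebra.ι ℂ (tpow k a))

/-- The algebra `N(ĥ)`. -/
abbrev NAlgebra (B : LinearMap.BilinForm ℂ h) : Type _ := RingQuot (NRel B)

/-- The image of an element of `ĥ` in `N(ĥ)`. -/
noncomputable def NAlgebra.of (B : LinearMap.BilinForm ℂ h) :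
    Affinization h →ₗ[ℂ] NAlgebra B :=
  (RingQuot.mkAlgHom ℂ (NRel B)).toLinearMap ∘ₗ TensorAlgebra.ι ℂ

variable (h) in
/-- The space `ĥ₋ = h ⊗ t⁻¹ℂ[t⁻¹]`; `Finsupp.single m a` is the element `a ⊗ t⁻ᵐ`, `m > 0`. -/
abbrev HMinus : Type _ := ℕ+ →₀ h

variable (h) in
/-- The tensor algebra `T(ĥ₋)`. -/
abbrev TMinus : Type _ := TensorAlgebra ℂ (HMinus h)

/-- The letter `a ⊗ t⁻ᵐ` as an element of `T(ĥ₋)`. -/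
noncomputable def letter (m : ℕ+) : h →ₗ[ℂ] TMinus h :=
  TensorAlgebra.ι ℂ ∘ₗ Finsupp.lsingle m

/-- The linear map `x ↦ x + ε f(x)` into the dual numbers over `T(ĥ₋)`. -/
noncomputable def contractionAux (f : Dual ℂ (HMinus h)) :
    HMinus h →ₗ[ℂ] DualNumber (TMinus h) where
  toFun x := TrivSqZeroExt.inl (TensorAlgebra.ι ℂ x) +
    TrivSqZeroExt.inr (f x • (1 : TMinus h))
  map_add' x y := by ext <;> simp [-TrivSqZeroExt.inr_smul, add_smul]
  map_smul' c x := by ext <;> simp [-TrivSqZeroExt.inr_smul, mul_smul]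

/-- The derivation of the algebra `T(ĥ₋)` that extends a linear functional `f` on `ĥ₋`:
`x₁ ⋯ xₖ ↦ ∑ₚ f(xₚ) x₁ ⋯ xₚ₋₁ xₚ₊₁ ⋯ xₖ`. -/
noncomputable def contraction (f : Dual ℂ (HMinus h)) : End ℂ (TMinus h) where
  toFun w := (TensorAlgebra.lift ℂ (contractionAux f) w).snd
  map_add' x y := by simp
  map_smul' c x := by simp

theorem fst_lift_contractionAux (f : Dual ℂ (HMinus h)) (w : TMinus h) :
    (TensorAlgebra.lift ℂ (contractionAux f) w).fst = w := by
  have H : (TrivSqZeroExt.fstHom ℂ (TMinus h) (TMinus h)).comp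
      (TensorAlgebra.lift ℂ (contractionAux f)) = AlgHom.id ℂ _ := by
    apply TensorAlgebra.hom_ext
    refine LinearMap.ext fun x => ?_
    simp [contractionAux, -TrivSqZeroExt.inr_smul]
  exact DFunLike.congr_fun H w

@[simp]
theorem contraction_one (f : Dual ℂ (HMinus h)) : contraction f 1 = 0 := by
  simp [contraction]

@[simp]
theorem contraction_ι (f : Dual ℂ (HMinus h)) (x : HMinus h) :
    contraction f (TensorAlgebra.ι ℂ x) = algebraMap ℂ _ (f x) := by
  simp [contraction, contractionAux, Algebra.algebraMap_eq_smul_one, -TrivSqZeroExt.inr_smul]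

theorem contraction_mul (f : Dual ℂ (HMinus h)) (v w : TMinus h) :
    contraction f (v * w) = v * contraction f w + contraction f v * w := by
  simp [contraction, fst_lift_contractionAux]

theorem contraction_ι_mul (f : Dual ℂ (HMinus h)) (x : HMinus h) (w : TMinus h) :
    contraction f (TensorAlgebra.ι ℂ x * w) =
      TensorAlgebra.ι ℂ x * contraction f w + f x • w := by
  rw [contraction_mul, contraction_ι, Algebra.smul_def]

theorem contraction_add (f g : Dual ℂ (HMinus h)) :
    contraction (f + g) = contraction f + contraction g := by
  ext w
  induction w using TensorAlgebra.induction with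
  | algebraMap r => simp [Algebra.algebraMap_eq_smul_one]
  | ι x => simp
  | mul a b ha hb => simp only [contraction_mul, ha, hb, LinearMap.add_apply]; noncomm_ring
  | add a b ha hb => simp only [map_add, ha, hb]

theorem contraction_smul (c : ℂ) (f : Dual ℂ (HMinus h)) :
    contraction (c • f) = c • contraction f := by
  ext w
  induction w using TensorAlgebra.induction with
  | algebraMap r => simp [Algebra.algebraMap_eq_smul_one]
  | ι x => simp [Algebra.algebraMap_eq_smul_one, mul_smul]
  | mul a b ha hb => simp [contraction_mul, ha, hb]
  | add a b ha hb => simp only [map_add, ha, hb]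

/-- The action on `T(ĥ₋)` of `a ⊗ tⁿ`. For `n < 0` it is left multiplication, for `n = 0` it is
zero, and for `n > 0` it annihilates `1` and satisfies
`[a ⊗ tⁿ, b ⊗ t⁻ᵐ] = n (a, b) δ_{n, m}`. -/
noncomputable def modeAux (B : LinearMap.BilinForm ℂ h) : ℤ → h →ₗ[ℂ] End ℂ (TMinus h)
  | .negSucc k => LinearMap.mul ℂ (TMinus h) ∘ₗ letter k.succPNat
  | .ofNat 0 => 0
  | .ofNat (k + 1) =>
    { toFun a := contraction (((k + 1 : ℕ) : ℂ) • (B a ∘ₗ Finsupp.lapply k.succPNat))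
      map_add' a b := by
        rw [← contraction_add, ← smul_add, map_add, LinearMap.add_comp]
      map_smul' c a := by
        rw [RingHom.id_apply, ← contraction_smul, smul_comm c, map_smul, LinearMap.smul_comp] }

/-- The action of `ĥ` on `T(ĥ₋)`, with `𝐤` acting as `1`. -/
noncomputable def affAction (B : LinearMap.BilinForm ℂ h) :
    Affinization h →ₗ[ℂ] End ℂ (TMinus h) :=
  LinearMap.coprod (Finsupp.lsum ℂ (modeAux B)) (LinearMap.toSpanSingleton ℂ _ 1)

theorem affAction_tpow (B : LinearMap.BilinForm ℂ h) (n : ℤ) (a : h) :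
    affAction B (tpow n a) = modeAux B n a := by
  simp [affAction, tpow]

theorem affAction_central (B : LinearMap.BilinForm ℂ h) :
    affAction B (centralElement h) = 1 := by
  simp [affAction, centralElement]

theorem affAction_rel (B : LinearMap.BilinForm ℂ h)
    ⦃x y : TensorAlgebra ℂ (Affinization h)⦄ (hxy : NRel B x y) :
    TensorAlgebra.lift ℂ (affAction B) x = TensorAlgebra.lift ℂ (affAction B) y := by
  cases hxy with
  | pos_neg a b m n hm hn =>
    simp only [map_mul, map_add, map_smul, TensorAlgebra.lift_ι_apply, affAction_tpow,
      affAction_central]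
    obtain ⟨k, rfl⟩ : ∃ k : ℕ, m = Int.ofNat (k + 1) :=
      ⟨(m - 1).toNat, by simp only [Int.ofNat_eq_natCast]; push_cast; omega⟩
    obtain ⟨l, rfl⟩ : ∃ l : ℕ, n = Int.negSucc l :=
      ⟨(-n - 1).toNat, by omega⟩
    refine LinearMap.ext fun w => ?_
    simp only [modeAux, letter, LinearMap.coe_mk, AddHom.coe_mk, LinearMap.comp_apply,
      End.mul_apply, LinearMap.mul_apply', contraction_ι_mul, LinearMap.add_apply,
      LinearMap.smul_apply, End.one_apply, Finsupp.lsingle_apply, Finsupp.lapply_apply]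
    congr 2
    by_cases hkl : k = l
    · subst hkl
      rw [if_pos (by simp only [Int.ofNat_eq_natCast]; omega)]
      simp
    · rw [if_neg (by simp only [Int.ofNat_eq_natCast]; omega), Finsupp.single_eq_of_ne]
      · simp
      · intro H
        exact hkl (Nat.succPNat_injective H)
  | zero a b k =>
    simp only [map_mul, TensorAlgebra.lift_ι_apply, affAction_tpow]
    have h0 : modeAux B 0 b = 0 := rfl
    rw [h0, mul_zero, zero_mul]
  | central a k =>
    simp only [map_mul, TensorAlgebra.lift_ι_apply, affAction_central, mul_one, one_mul]

/-- The left `N(ĥ)`-module structure on `T(ĥ₋)`: this is the module induced from the trivial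
module `ℂ`, on which `ĥ₊` and `h ⊗ t⁰` act as `0` and `𝐤` acts as `1`, in the canonical
identification of its underlying space with `T(ĥ₋) ⊗ ℂ ≃ T(ĥ₋)`. -/
noncomputable def action (B : LinearMap.BilinForm ℂ h) : NAlgebra B →ₐ[ℂ] End ℂ (TMinus h) :=
  RingQuot.liftAlgHom ℂ ⟨TensorAlgebra.lift ℂ (affAction B), affAction_rel B⟩

/-- The operator `a(n)` on `T(ĥ₋)`: the representation image of `a ⊗ tⁿ`. -/
noncomputable def mode (B : LinearMap.BilinForm ℂ h) (n : ℤ) : h →ₗ[ℂ] End ℂ (TMinus h) :=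
  (action B).toLinearMap ∘ₗ NAlgebra.of B ∘ₗ tpow n

theorem mode_eq (B : LinearMap.BilinForm ℂ h) (n : ℤ) (a : h) : mode B n a = modeAux B n a := by
  simp only [mode, action, NAlgebra.of, LinearMap.comp_apply, AlgHom.toLinearMap_apply,
    RingQuot.liftAlgHom_mkAlgHom_apply, TensorAlgebra.lift_ι_apply, affAction_tpow]

/-- The element `a₁(-m₁) ⋯ aₖ(-mₖ)𝟏` of `T(ĥ₋)`. -/
noncomputable def word {k : ℕ} (m : Fin k → ℕ+) (a : Fin k → h) : TMinus h :=
  (List.ofFn fun i => letter (m i) (a i)).prod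

variable (h) in
/-- The homogeneous subspace of `T(ĥ₋)` of weight `n`, spanned by the elements
`a₁(-m₁) ⋯ aₖ(-mₖ)𝟏` with `m₁ + ⋯ + mₖ = n`. -/
noncomputable def weightSpace (n : ℤ) : Submodule ℂ (TMinus h) :=
  Submodule.span ℂ {w | ∃ (k : ℕ) (m : Fin k → ℕ+) (a : Fin k → h),
    ∑ i, ((m i : ℕ) : ℤ) = n ∧ w = word m a}

/-! ### Normal ordering and vertex operators -/

/-- The normally ordered product of `a₁(n₁), …, aₖ(nₖ)`: the factors with `nᵢ < 0` come first,
then those with `nᵢ > 0`, then those with `nᵢ = 0`, and the order within each of the three groups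
is kept. -/
noncomputable def normalOrder (B : LinearMap.BilinForm ℂ h) {k : ℕ} (n : Fin k → ℤ)
    (a : Fin k → h) : End ℂ (TMinus h) :=
  (((List.finRange k).filter (fun i => n i < 0) ++
    (List.finRange k).filter (fun i => 0 < n i) ++
    (List.finRange k).filter (fun i => n i = 0)).map fun i => mode B (n i) (a i)).prod

/-- The scalar `c` in `1/(m-1)! (d/dx)^(m-1) x^(-n-1) = c x^(-n-m)`, namely the binomial
coefficient `(-n-1 choose m-1)`. -/
noncomputable def derivCoeff (m : ℕ+) (n : ℤ) : ℂ :=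
  ((Ring.choose (-n - 1) (m.natPred) : ℤ) : ℂ)

/-- Applied to `v`, the coefficient of `x ^ N` in
`: (1/(m₁-1)! (d/dx)^(m₁-1) a₁(x)) ⋯ (1/(mₖ-1)! (d/dx)^(mₖ-1) aₖ(x)) :` has, for each
`(n₁, …, nₖ)`, the following contribution from the modes `a₁(n₁), …, aₖ(nₖ)`. -/
noncomputable def vertexTerm (B : LinearMap.BilinForm ℂ h) {k : ℕ} (m : Fin k → ℕ+)
    (a : Fin k → h) (N : ℤ) (v : TMinus h) (n : Fin k → ℤ) : TMinus h :=
  if ∑ i, (-n i - ((m i : ℕ) : ℤ)) = N then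
    (∏ i, derivCoeff (m i) (n i)) • normalOrder B n a v else 0

/-- `Y` is given by
`Y(a₁(-m₁) ⋯ aₖ(-mₖ)𝟏, x) = : (1/(m₁-1)! (d/dx)^(m₁-1) a₁(x)) ⋯ (1/(mₖ-1)! (d/dx)^(mₖ-1) aₖ(x)) :`
where `a(x) = ∑ₙ a(n) x^(-n-1)`; on each vector, each coefficient is a finite sum. -/
def IsVertexOperatorMap (B : LinearMap.BilinForm ℂ h)
    (Y : TMinus h →ₗ[ℂ] FormalDist (End ℂ (TMinus h))) : Prop :=
  ∀ (k : ℕ) (m : Fin k → ℕ+) (a : Fin k → h) (N : ℤ) (v : TMinus h),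
    (Function.support (vertexTerm B m a N v)).Finite ∧
      Y (word m a) N v = ∑ᶠ n : Fin k → ℤ, vertexTerm B m a N v n

/-! The series defining the vertex operators are finite on each vector and multilinear. -/

/-- The filtration of `T(ĥ₋)` by weight. -/
noncomputable def weightLE (h : Type*) [AddCommGroup h] [Module ℂ h] (K : ℤ) :
    Submodule ℂ (TMinus h) :=
  Submodule.span ℂ {w | ∃ l : List (ℕ+ × h), (l.map fun p => ((p.1 : ℕ) : ℤ)).sum ≤ K ∧
    w = (l.map fun p => letter p.1 p.2).prod}

theorem weightLE_mono {K L : ℤ} (hKL : K ≤ L) : weightLE h K ≤ weightLE h L :=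
  Submodule.span_mono fun _ ⟨l, hl, hw⟩ => ⟨l, hl.trans hKL, hw⟩

theorem weightLE_neg {K : ℤ} (hK : K < 0) : weightLE h K = ⊥ := by
  rw [weightLE, Submodule.span_eq_bot]
  rintro w ⟨l, hl, -⟩
  have : 0 ≤ (l.map fun p => ((p.1 : ℕ) : ℤ)).sum := by
    apply List.sum_nonneg
    simp only [List.mem_map]
    rintro x ⟨p, -, rfl⟩
    positivity
  omega

theorem letter_mul_mem {K : ℤ} (m : ℕ+) (a : h) {w : TMinus h} (hw : w ∈ weightLE h K) :
    letter m a * w ∈ weightLE h (K + (m : ℕ)) := by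
  induction hw using Submodule.span_induction with
  | mem x hx =>
    obtain ⟨l, hl, rfl⟩ := hx
    refine Submodule.subset_span ⟨(m, a) :: l, ?_, ?_⟩
    · simp only [List.map_cons, List.sum_cons]; omega
    · simp
  | zero => simp
  | add x y _ _ hx hy => rw [mul_add]; exact add_mem hx hy
  | smul c x _ hx => rw [mul_smul_comm]; exact Submodule.smul_mem _ _ hx

theorem mem_weightLE (w : TMinus h) : ∃ K : ℤ, w ∈ weightLE h K := by
  let S : Submodule ℂ (TMinus h) :=
    { carrier := {w | ∃ K : ℤ, w ∈ weightLE h K}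
      add_mem' := by
        rintro x y ⟨K, hK⟩ ⟨L, hL⟩
        exact ⟨max K L, add_mem (weightLE_mono (le_max_left _ _) hK)
          (weightLE_mono (le_max_right _ _) hL)⟩
      zero_mem' := ⟨0, zero_mem _⟩
      smul_mem' := by
        rintro c x ⟨K, hK⟩
        exact ⟨K, Submodule.smul_mem _ _ hK⟩ }
  have hι : ∀ x : HMinus h, ∀ w ∈ S, TensorAlgebra.ι ℂ x * w ∈ S := by
    intro x w hw
    induction x using Finsupp.induction_linear with
    | zero => simp
    | add x y hx hy => rw [map_add, add_mul]; exact add_mem hx hy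
    | single m a =>
      obtain ⟨K, hK⟩ := hw
      exact ⟨_, letter_mul_mem m a hK⟩
  have key : ∀ v w : TMinus h, w ∈ S → v * w ∈ S := by
    intro v
    induction v using TensorAlgebra.induction with
    | algebraMap r =>
      intro w hw
      rw [← Algebra.smul_def]
      exact Submodule.smul_mem _ _ hw
    | ι x => exact hι x
    | mul a b ha hb => intro w hw; rw [mul_assoc]; exact ha _ (hb _ hw)
    | add a b ha hb => intro w hw; rw [add_mul]; exact add_mem (ha _ hw) (hb _ hw)
  have h1 : (1 : TMinus h) ∈ S := ⟨0, Submodule.subset_span ⟨[], by simp, by simp⟩⟩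
  have := key w 1 h1
  rwa [mul_one] at this

theorem mode_pos_mem (B : LinearMap.BilinForm ℂ h) {K n : ℤ} (hn : 0 < n) (a : h)
    {w : TMinus h} (hw : w ∈ weightLE h K) : mode B n a w ∈ weightLE h (K - n) := by
  obtain ⟨k, rfl⟩ : ∃ k : ℕ, n = Int.ofNat (k + 1) :=
    ⟨(n - 1).toNat, by simp only [Int.ofNat_eq_natCast]; push_cast; omega⟩
  rw [mode_eq]
  induction hw using Submodule.span_induction with
  | mem x hx =>
    obtain ⟨l, hl, rfl⟩ := hx
    refine weightLE_mono (K := (l.map fun p => ((p.1 : ℕ) : ℤ)).sum - Int.ofNat (k + 1))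
      (by omega) ?_
    clear hl
    induction l with
    | nil => simp [modeAux]
    | cons p l ih =>
      simp only [List.map_cons, List.prod_cons, List.sum_cons]
      have h1 : modeAux B (Int.ofNat (k + 1)) a
          (letter p.1 p.2 * (l.map fun p => letter p.1 p.2).prod) =
          letter p.1 p.2 *
            modeAux B (Int.ofNat (k + 1)) a ((l.map fun p => letter p.1 p.2).prod) +
          (((k + 1 : ℕ) : ℂ) * B a (Finsupp.single p.1 p.2 k.succPNat)) •
            (l.map fun p => letter p.1 p.2).prod := by
        simp only [modeAux, LinearMap.coe_mk, AddHom.coe_mk, letter, LinearMap.comp_apply,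
          contraction_ι_mul, LinearMap.smul_apply, Finsupp.lapply_apply, smul_eq_mul,
          Finsupp.lsingle_apply]
      rw [h1]
      refine add_mem ?_ ?_
      · have := letter_mul_mem p.1 p.2 ih
        refine weightLE_mono ?_ this
        omega
      · by_cases hp : k.succPNat = p.1
        · refine Submodule.smul_mem _ _ (Submodule.subset_span ⟨l, ?_, rfl⟩)
          rw [← hp]
          simp only [Nat.succPNat_coe, Int.ofNat_eq_natCast]
          omega
        · rw [Finsupp.single_eq_of_ne hp]
          simp
  | zero => simp
  | add x y _ _ hx hy => rw [map_add]; exact add_mem hx hy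
  | smul c x _ hx => rw [map_smul]; exact Submodule.smul_mem _ _ hx

theorem mode_prod_pos_mem (B : LinearMap.BilinForm ℂ h) {k : ℕ} (n : Fin k → ℤ)
    (a : Fin k → h) (l : List (Fin k)) (hl : ∀ i ∈ l, 0 < n i) {K : ℤ} {w : TMinus h}
    (hw : w ∈ weightLE h K) :
    (l.map fun i => mode B (n i) (a i)).prod w ∈ weightLE h (K - (l.map n).sum) := by
  induction l with
  | nil => simpa using hw
  | cons i l ih =>
    have := mode_pos_mem B (hl i (by simp)) (a i) (ih fun j hj => hl j (by simp [hj]))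
    simp only [List.map_cons, List.prod_cons, List.sum_cons, End.mul_apply]
    exact weightLE_mono (by omega) this

theorem mode_prod_zero_mem (B : LinearMap.BilinForm ℂ h) {k : ℕ} (n : Fin k → ℤ)
    (a : Fin k → h) (l : List (Fin k)) (hl : ∀ i ∈ l, n i = 0) {K : ℤ} {w : TMinus h}
    (hw : w ∈ weightLE h K) :
    (l.map fun i => mode B (n i) (a i)).prod w ∈ weightLE h K := by
  cases l with
  | nil => simpa using hw
  | cons i l =>
    have h0 : mode B (n i) (a i) = 0 := by
      rw [mode_eq, hl i (by simp)]; rfl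
    simp [h0]

theorem normalOrder_eq_zero (B : LinearMap.BilinForm ℂ h) {k : ℕ} (n : Fin k → ℤ)
    (a : Fin k → h) {K : ℤ} {v : TMinus h} (hv : v ∈ weightLE h K) (i : Fin k) (hi : 0 < n i)
    (hK : K < n i) : normalOrder B n a v = 0 := by
  rw [normalOrder, List.map_append, List.map_append, List.prod_append, List.prod_append,
    End.mul_apply, End.mul_apply]
  have h1 := mode_prod_zero_mem B n a ((List.finRange k).filter (fun i => n i = 0))
    (by simp) hv
  have h2 := mode_prod_pos_mem B n a ((List.finRange k).filter (fun i => 0 < n i))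
    (by simp) h1
  have h3 : n i ≤ (((List.finRange k).filter (fun i => 0 < n i)).map n).sum := by
    apply List.single_le_sum
    · simp only [List.mem_map, List.mem_filter, decide_eq_true_eq]
      rintro x ⟨j, ⟨-, hj⟩, rfl⟩
      exact hj.le
    · exact List.mem_map_of_mem (by simp [hi])
  rw [weightLE_neg (by omega), Submodule.mem_bot] at h2
  rw [h2, map_zero]

theorem vertexTerm_support_finite (B : LinearMap.BilinForm ℂ h) {k : ℕ} (m : Fin k → ℕ+)
    (a : Fin k → h) (N : ℤ) (v : TMinus h) :
    (Function.support (vertexTerm B m a N v)).Finite := by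
  obtain ⟨K, hv⟩ := mem_weightLE v
  set M : ℤ := max K 0 with hM
  set C : ℤ := -N - ∑ i, ((m i : ℕ) : ℤ) with hC
  refine (Set.Finite.pi' fun _ : Fin k => Set.finite_Icc (C - k * M) M).subset ?_
  intro n hn
  rw [Function.mem_support] at hn
  have hsum : ∑ i, (-n i - ((m i : ℕ) : ℤ)) = N := by
    by_contra H
    exact hn (by rw [vertexTerm, if_neg H])
  have hle : ∀ i, n i ≤ M := by
    intro i
    by_contra H
    apply hn
    rw [vertexTerm, normalOrder_eq_zero B n a hv i (by omega) (by omega), smul_zero, ite_self]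
  have hS : ∑ i, n i = C := by
    rw [Finset.sum_sub_distrib, Finset.sum_neg_distrib] at hsum
    omega
  intro i
  refine ⟨?_, hle i⟩
  rw [← Finset.add_sum_erase _ _ (Finset.mem_univ i)] at hS
  have : ∑ j ∈ Finset.univ.erase i, n j ≤ k * M := by
    calc ∑ j ∈ Finset.univ.erase i, n j ≤ ∑ j ∈ Finset.univ.erase i, M :=
          Finset.sum_le_sum fun j _ => hle j
      _ ≤ ∑ j : Fin k, M := Finset.sum_le_sum_of_subset_of_nonneg (Finset.erase_subset _ _)
          fun _ _ _ => by omega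
      _ = k * M := by simp
  omega

theorem mode_prod_update_add (B : LinearMap.BilinForm ℂ h) {k : ℕ} (n : Fin k → ℤ)
    [DecidableEq (Fin k)] (a : Fin k → h) (i : Fin k) (x y : h) (l : List (Fin k))
    (hl : l.Nodup) (hi : i ∈ l) :
    (l.map fun j => mode B (n j) (Function.update a i (x + y) j)).prod =
      (l.map fun j => mode B (n j) (Function.update a i x j)).prod +
        (l.map fun j => mode B (n j) (Function.update a i y j)).prod := by
  induction l with
  | nil => simp at hi
  | cons j l ih =>
    rw [List.nodup_cons] at hl
    simp only [List.map_cons, List.prod_cons]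
    by_cases hij : j = i
    · subst hij
      have : ∀ z, (l.map fun q => mode B (n q) (Function.update a j z q)) =
          l.map fun q => mode B (n q) (a q) := fun z =>
        List.map_congr_left fun q hq => by
          rw [Function.update_of_ne (by rintro rfl; exact hl.1 hq)]
      simp only [this, Function.update_self, map_add, add_mul]
    · rw [ih hl.2 (by simpa [Ne.symm hij] using hi)]
      simp only [Function.update_of_ne hij, mul_add]

theorem mode_prod_update_smul (B : LinearMap.BilinForm ℂ h) {k : ℕ} (n : Fin k → ℤ)
    [DecidableEq (Fin k)] (a : Fin k → h) (i : Fin k) (c : ℂ) (x : h) (l : List (Fin k))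
    (hl : l.Nodup) (hi : i ∈ l) :
    (l.map fun j => mode B (n j) (Function.update a i (c • x) j)).prod =
      c • (l.map fun j => mode B (n j) (Function.update a i x j)).prod := by
  induction l with
  | nil => simp at hi
  | cons j l ih =>
    rw [List.nodup_cons] at hl
    simp only [List.map_cons, List.prod_cons]
    by_cases hij : j = i
    · subst hij
      have : ∀ z, (l.map fun q => mode B (n q) (Function.update a j z q)) =
          l.map fun q => mode B (n q) (a q) := fun z =>
        List.map_congr_left fun q hq => by
          rw [Function.update_of_ne (by rintro rfl; exact hl.1 hq)]
      simp only [this, Function.update_self, map_smul, smul_mul_assoc]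
    · rw [ih hl.2 (by simpa [Ne.symm hij] using hi)]
      simp only [Function.update_of_ne hij, mul_smul_comm]

theorem normalOrder_list_nodup {k : ℕ} (n : Fin k → ℤ) :
    ((List.finRange k).filter (fun i => n i < 0) ++
      (List.finRange k).filter (fun i => 0 < n i) ++
      (List.finRange k).filter (fun i => n i = 0)).Nodup := by
  have H := List.nodup_finRange k
  simp only [List.nodup_append', H.filter, List.disjoint_left, List.mem_append, List.mem_filter,
    decide_eq_true_eq, true_and]
  grind

theorem normalOrder_list_mem {k : ℕ} (n : Fin k → ℤ) (i : Fin k) :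
    i ∈ (List.finRange k).filter (fun i => n i < 0) ++
      (List.finRange k).filter (fun i => 0 < n i) ++
      (List.finRange k).filter (fun i => n i = 0) := by
  simp
  omega

/-- The coefficient of `x ^ N` in the normally ordered product of derivatives of fields. -/
noncomputable def vertexCoeff (B : LinearMap.BilinForm ℂ h) {k : ℕ} (m : Fin k → ℕ+)
    (a : Fin k → h) (N : ℤ) : End ℂ (TMinus h) where
  toFun v := ∑ᶠ n : Fin k → ℤ, vertexTerm B m a N v n
  map_add' v w := by
    rw [← finsum_add_distrib (vertexTerm_support_finite B m a N v)
      (vertexTerm_support_finite B m a N w)]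
    refine finsum_congr fun n => ?_
    simp only [vertexTerm]
    split_ifs <;> simp
  map_smul' c v := by
    rw [RingHom.id_apply, smul_finsum' c (vertexTerm_support_finite B m a N v)]
    refine finsum_congr fun n => ?_
    simp only [vertexTerm]
    split_ifs
    · rw [map_smul, smul_comm]
    · simp

/-- The vertex operator of `a₁(-m₁) ⋯ aₖ(-mₖ)𝟏` depends multilinearly on `a₁, …, aₖ`. -/
noncomputable def vertexMultilinear (B : LinearMap.BilinForm ℂ h) {k : ℕ} (m : Fin k → ℕ+) :
    MultilinearMap ℂ (fun _ : Fin k => h) (FormalDist (End ℂ (TMinus h))) where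
  toFun a N := vertexCoeff B m a N
  map_update_add' a i x y := by
    refine funext fun N => LinearMap.ext fun v => ?_
    simp only [Pi.add_apply, LinearMap.add_apply, vertexCoeff, LinearMap.coe_mk, AddHom.coe_mk]
    rw [← finsum_add_distrib (vertexTerm_support_finite B m _ N v)
      (vertexTerm_support_finite B m _ N v)]
    refine finsum_congr fun n => ?_
    simp only [vertexTerm, normalOrder]
    rw [mode_prod_update_add B n a i x y _ (normalOrder_list_nodup n) (normalOrder_list_mem n i)]
    split_ifs <;> simp
  map_update_smul' a i c x := by
    refine funext fun N => LinearMap.ext fun v => ?_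
    simp only [Pi.smul_apply, LinearMap.smul_apply, vertexCoeff, LinearMap.coe_mk, AddHom.coe_mk]
    rw [smul_finsum' c (vertexTerm_support_finite B m _ N v)]
    refine finsum_congr fun n => ?_
    simp only [vertexTerm, normalOrder]
    rw [mode_prod_update_smul B n a i c x _ (normalOrder_list_nodup n) (normalOrder_list_mem n i)]
    split_ifs
    · rw [LinearMap.smul_apply, smul_comm]
    · simp

/-- A basis of `T(ĥ₋)` consisting of words. -/
theorem exists_word_basis (h : Type*) [AddCommGroup h] [Module ℂ h] :
    ∃ (ι : Set h) (b : Basis ι ℂ h) (tb : Basis (Σ k : ℕ, Fin k → ℕ+ × ι) ℂ (TMinus h)),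
      ∀ p, tb p = word (fun i => (p.2 i).1) (fun i => b (p.2 i).2) := by
  let b := Basis.ofVectorSpace ℂ h
  let c : Basis (ℕ+ × Basis.ofVectorSpaceIndex ℂ h) ℂ (HMinus h) :=
    (Finsupp.basis fun _ : ℕ+ => b).reindex (Equiv.sigmaEquivProd _ _)
  let e : FreeMonoid (ℕ+ × Basis.ofVectorSpaceIndex ℂ h) ≃
      Σ k : ℕ, Fin k → ℕ+ × Basis.ofVectorSpaceIndex ℂ h :=
    FreeMonoid.toList.trans List.equivSigmaTuple
  refine ⟨_, b, c.tensorAlgebra.reindex e, fun p => ?_⟩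
  have h1 : ∀ l : List (ℕ+ × Basis.ofVectorSpaceIndex ℂ h),
      c.tensorAlgebra (FreeMonoid.ofList l) =
        (l.map fun q => TensorAlgebra.ι ℂ (c q)).prod := by
    intro l
    rw [Basis.tensorAlgebra, Basis.map_apply]
    have : FreeAlgebra.basisFreeMonoid ℂ (ℕ+ × Basis.ofVectorSpaceIndex ℂ h)
        (FreeMonoid.ofList l) = (l.map fun q => FreeAlgebra.ι ℂ q).prod := by
      simp [FreeAlgebra.basisFreeMonoid, FreeAlgebra.equivMonoidAlgebraFreeMonoid,
        FreeMonoid.lift_apply]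
    rw [this]
    simp [map_list_prod, Function.comp_def]
  have h2 : e.symm p = FreeMonoid.ofList (List.ofFn p.2) := rfl
  rw [Basis.reindex_apply, h2, h1, List.map_ofFn]
  simp [word, letter, c, Function.comp_def]

theorem existsUnique_isVertexOperatorMap (B : LinearMap.BilinForm ℂ h) :
    ∃! Y, IsVertexOperatorMap B Y := by
  obtain ⟨ι, b, tb, htb⟩ := exists_word_basis h
  refine ⟨tb.constr ℂ fun p =>
    vertexMultilinear B (fun i => (p.2 i).1) (fun i => b (p.2 i).2), ?_, ?_⟩
  · intro k m a N v
    refine ⟨vertexTerm_support_finite B m a N v, ?_⟩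
    set Y := tb.constr ℂ fun p =>
      vertexMultilinear B (fun i => (p.2 i).1) (fun i => b (p.2 i).2) with hY
    have H : Y.compMultilinearMap ((MultilinearMap.mkPiAlgebraFin ℂ k (TMinus h)).compLinearMap
        fun i => letter (m i)) = vertexMultilinear B m := by
      refine Basis.ext_multilinear (fun _ => b) fun f => ?_
      have := htb ⟨k, fun i => (m i, f i)⟩
      simp only [LinearMap.compMultilinearMap_apply, MultilinearMap.compLinearMap_apply,
        MultilinearMap.mkPiAlgebraFin_apply]
      simp only [word] at this
      rw [← this, hY, Basis.constr_basis]
    have H' := congrFun (DFunLike.congr_fun H a) N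
    simp only [LinearMap.compMultilinearMap_apply, MultilinearMap.compLinearMap_apply,
        MultilinearMap.mkPiAlgebraFin_apply] at H'
    exact DFunLike.congr_fun H' v
  · intro Y hY
    refine tb.ext fun p => ?_
    rw [Basis.constr_basis, htb]
    refine funext fun N => LinearMap.ext fun v => ?_
    rw [(hY _ _ _ N v).2]
    rfl

/-- The vertex operator map of `T(ĥ₋)`: the unique linear map given on the spanning elements
`a₁(-m₁) ⋯ aₖ(-mₖ)𝟏` by the normally ordered products of derivatives of fields. -/
noncomputable def vertexOperatorMap (B : LinearMap.BilinForm ℂ h) :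
    TMinus h →ₗ[ℂ] FormalDist (End ℂ (TMinus h)) :=
  (existsUnique_isVertexOperatorMap B).choose

theorem isVertexOperatorMap_vertexOperatorMap (B : LinearMap.BilinForm ℂ h) :
    IsVertexOperatorMap B (vertexOperatorMap B) :=
  (existsUnique_isVertexOperatorMap B).choose_spec.1

end Construction

end Mosva

/-! The negative modes are left multiplications in a free algebra and satisfy no relations among
themselves, so the fields are not mutually local and the commutativity arguments of ordinary vertex
algebras do not apply. They are replaced by a recursion in the first letter of a vector. Nonnegative
modes commute with one another, so normal ordering gives Y(a(-m)u, x) = a⁻(x)Y(u, x) + Y(u, x)a⁺(x),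
where a⁻ and a⁺ are the creation and annihilation parts of the (m-1)-st divided derivative of a(x);
this is `vertexOperatorMap_letter_mul`. Every vector arises from 𝟏 by sums, scalars and left
multiplication by letters (`TMinus.induction`), so each property of Y becomes an induction driven by
this recursion.

The properties of D and d reduce term by term to [D, a(n)] = -n a(n-1) and [d, a(n)] = -n a(n),
together with identities between binomial coefficients.

For convergence, the essential input is [a(n), Y(u, x)] = ∑ₚ (n choose p) x^(n-p) Y(a(p)u, x) for n
> 0 (`mode_vertexOperatorMap`). In ⟨φ, Y(a(-m)u, z₀)Y(u₁, z₁)⋯v⟩ the creation modes of a are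
absorbed into φ, and the annihilation modes travel right until they reach v. Passing Y(uⱼ, zⱼ)
leaves contractions whose sum over all modes is a multiple of (z₀ - zⱼ)^(-m-p), with uⱼ replaced by
a(p)uⱼ. Only finitely many p matter, because φ vanishes in high weight and a(p) kills any given
vector for large p. The matrix element is thus a finite combination of simpler ones, with
coefficients Laurent monomials in z₀ or z₀ - zⱼ; induction gives absolute convergence and
rationality (`exists_isRational_product`).

For an iterate the recursion is used twice, once inside and once outside, and Taylor's formula
recombines z₂ and z₁ - z₂ into z₁. The outcome is exactly the recursion for a product of two fields.
Hence one rational function is the sum of both series, each in its own domain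
(`exists_isRational_product_iterate`), and associativity follows without analytic continuation. -/

namespace Mosva

/-! ### Families of finite support and their sums -/

section Finsum

variable {ι κ M N : Type*} [AddCommGroup M] [AddCommGroup N]

/-- The family `f` has finite support and sum `s`. -/
def HasFinsum (f : ι → M) (s : M) : Prop :=
  (Function.support f).Finite ∧ ∑ᶠ i, f i = s

theorem HasFinsum.unique {f : ι → M} {s t : M} (hs : HasFinsum f s) (ht : HasFinsum f t) :
    s = t := hs.2.symm.trans ht.2

theorem HasFinsum.add {f g : ι → M} {s t : M} (hf : HasFinsum f s) (hg : HasFinsum g t) :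
    HasFinsum (fun i => f i + g i) (s + t) :=
  ⟨(hf.1.union hg.1).subset (Function.support_add f g), by
    rw [finsum_add_distrib hf.1 hg.1, hf.2, hg.2]⟩

theorem hasFinsum_zero : HasFinsum (fun _ : ι => (0 : M)) 0 :=
  ⟨by simp, finsum_zero⟩

theorem HasFinsum.sum {f : κ → ι → M} {s : κ → M} (S : Finset κ)
    (hf : ∀ j ∈ S, HasFinsum (f j) (s j)) :
    HasFinsum (fun i => ∑ j ∈ S, f j i) (∑ j ∈ S, s j) := by
  classical
  induction S using Finset.induction_on with
  | empty => simpa using hasFinsum_zero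
  | insert j S hj ih =>
    simp only [Finset.sum_insert hj]
    exact (hf j (by simp)).add (ih fun i hi => hf i (by simp [hi]))

theorem HasFinsum.map {f : ι → M} {s : M} (hf : HasFinsum f s) (g : M →+ N) :
    HasFinsum (fun i => g (f i)) (g s) :=
  ⟨hf.1.subset (Function.support_comp_subset g.map_zero f), by
    rw [← hf.2, g.map_finsum hf.1]⟩

theorem HasFinsum.map_linear [Module ℂ M] [Module ℂ N]
    {f : ι → M} {s : M} (hf : HasFinsum f s) (g : M →ₗ[ℂ] N) :
    HasFinsum (fun i => g (f i)) (g s) := hf.map g.toAddMonoidHom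

theorem HasFinsum.sub {f g : ι → M} {s t : M} (hf : HasFinsum f s) (hg : HasFinsum g t) :
    HasFinsum (fun i => f i - g i) (s - t) := by
  simpa only [sub_eq_add_neg] using! hf.add (hg.map (-AddMonoidHom.id M))

theorem HasFinsum.smul {f : ι → M} {s : M} [Module ℂ M] (hf : HasFinsum f s) (c : ℂ) :
    HasFinsum (fun i => c • f i) (c • s) :=
  hf.map_linear (LinearMap.lsmul ℂ M c)

theorem HasFinsum.comp_equiv {f : ι → M} {s : M} (hf : HasFinsum f s) (e : κ ≃ ι) :
    HasFinsum (fun i => f (e i)) s :=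
  ⟨hf.1.preimage e.injective.injOn, by rw [finsum_comp_equiv e, hf.2]⟩

theorem hasFinsum_single {f : ι → M} (i : ι) (hf : ∀ j ≠ i, f j = 0) : HasFinsum f (f i) :=
  ⟨(Set.finite_singleton i).subset fun j hj => by
    by_contra h
    exact hj (hf j h), finsum_eq_single f i hf⟩

/-- This isolates the first mode of a normally ordered product: the remaining modes are summed for
each fixed value of the first. -/
theorem HasFinsum.curry {f : ι × κ → M} {s : M} (hf : HasFinsum f s) {g : ι → M}
    (hg : ∀ i, HasFinsum (fun j => f (i, j)) (g i)) : HasFinsum g s := by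
  have hg' : ∀ i, g i = ∑ᶠ j, f (i, j) := fun i => (hg i).2.symm
  constructor
  · refine (hf.1.image Prod.fst).subset fun i hi => ?_
    by_contra H
    apply hi
    rw [hg' i]
    refine finsum_eq_zero_of_forall_eq_zero fun j => ?_
    by_contra hj
    exact H ⟨(i, j), hj, rfl⟩
  · rw [finsum_congr hg', ← finsum_curry f hf.1, hf.2]

theorem HasFinsum.hasSum [TopologicalSpace M] {f : ι → M} {s : M} (hf : HasFinsum f s) :
    HasSum f s := by
  rw [← hf.2, finsum_eq_sum f hf.1]
  exact hasSum_sum_of_ne_finset_zero fun b hb => by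
    simpa using hb

end Finsum

/-! ### Induction over words in the letters -/

variable {h : Type*} [AddCommGroup h] [Module ℂ h]

/-- Multiplying 𝟏 from the left by letters, and closing under linear combinations, exhausts the
tensor algebra. The left-handed form matches the recursion for Y, which removes the leftmost letter.
-/
theorem TMinus.induction {P : TMinus h → Prop} (one : P 1)
    (add : ∀ u v, P u → P v → P (u + v)) (smul : ∀ (c : ℂ) u, P u → P (c • u))
    (letter_mul : ∀ (m : ℕ+) (a : h) u, P u → P (letter m a * u)) (u : TMinus h) : P u := by
  have hι : ∀ (x : HMinus h) (w : TMinus h), P w → P (TensorAlgebra.ι ℂ x * w) := by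
    intro x w hw
    induction x using Finsupp.induction_linear with
    | zero => simpa using smul 0 w hw
    | add x y hx hy => rw [map_add, add_mul]; exact add _ _ hx hy
    | single m a => exact letter_mul m a w hw
  have key : ∀ v w : TMinus h, P w → P (v * w) := by
    intro v
    induction v using TensorAlgebra.induction with
    | algebraMap r =>
      intro w hw
      rw [← Algebra.smul_def]
      exact smul _ _ hw
    | ι x => exact hι x
    | mul a b ha hb => intro w hw; rw [mul_assoc]; exact ha _ (hb _ hw)
    | add a b ha hb => intro w hw; rw [add_mul]; exact add _ _ (ha _ hw) (hb _ hw)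
  simpa using key u 1 one

theorem letter_mul_word {k : ℕ} (m : ℕ+) (a : h) (m' : Fin k → ℕ+) (a' : Fin k → h) :
    letter m a * word m' a' =
      word (Fin.cons m m' : Fin (k + 1) → ℕ+) (Fin.cons a a' : Fin (k + 1) → h) := by
  simp [word, List.ofFn_succ]

theorem word_zero (m : Fin 0 → ℕ+) (a : Fin 0 → h) : word m a = 1 := by
  simp [word]

theorem span_words :
    Submodule.span ℂ {w : TMinus h | ∃ (k : ℕ) (m : Fin k → ℕ+) (a : Fin k → h), w = word m a}
      = ⊤ := by
  rw [eq_top_iff]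
  rintro u -
  induction u using TMinus.induction with
  | one => exact Submodule.subset_span ⟨0, Fin.elim0, Fin.elim0, (word_zero _ _).symm⟩
  | add u v hu hv => exact add_mem hu hv
  | smul c u hu => exact Submodule.smul_mem _ c hu
  | letter_mul m a u hu =>
    induction hu using Submodule.span_induction with
    | mem x hx =>
      obtain ⟨k, m', a', rfl⟩ := hx
      exact Submodule.subset_span ⟨_, _, _, letter_mul_word m a m' a'⟩
    | zero => simp
    | add x y _ _ hx hy => rw [mul_add]; exact add_mem hx hy
    | smul c x _ hx => rw [mul_smul_comm]; exact Submodule.smul_mem _ c hx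

/-! ### Modes, normal ordering and the recursion for vertex operators -/

section Recursion

variable (B : LinearMap.BilinForm ℂ h)

theorem mode_neg (m : ℕ+) (a : h) (w : TMinus h) : mode B (-(m : ℕ)) a w = letter m a * w := by
  obtain ⟨k, rfl⟩ : ∃ k : ℕ, m = k.succPNat := ⟨m.natPred, by simp⟩
  have : (-((k.succPNat : ℕ) : ℤ)) = Int.negSucc k := by
    rw [Nat.succPNat_coe, Int.negSucc_eq]; push_cast; ring
  rw [mode_eq, this]
  rfl

@[simp]
theorem mode_zero (a : h) : mode B 0 a = 0 := by
  rw [mode_eq]; rfl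

theorem mode_pnat (m : ℕ+) (a : h) :
    mode B (m : ℕ) a = contraction (((m : ℕ) : ℂ) • (B a ∘ₗ Finsupp.lapply m)) := by
  obtain ⟨k, rfl⟩ : ∃ k : ℕ, m = k.succPNat := ⟨m.natPred, by simp⟩
  rw [mode_eq]
  rfl

theorem mode_pnat_one (n : ℕ+) (a : h) : mode B (n : ℕ) a 1 = 0 := by
  rw [mode_pnat, contraction_one]

theorem mode_pnat_letter_mul (n m : ℕ+) (a b : h) (w : TMinus h) :
    mode B (n : ℕ) a (letter m b * w) = letter m b * mode B (n : ℕ) a w +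
      (if n = m then ((n : ℕ) : ℂ) * B a b else 0) • w := by
  rw [mode_pnat, letter, LinearMap.comp_apply, contraction_ι_mul]
  congr 2
  by_cases hnm : n = m
  · subst hnm; simp
  · rw [if_neg hnm]
    simp [Finsupp.single_eq_of_ne hnm]

theorem pnat_of_pos {n : ℤ} (hn : 0 < n) : ∃ p : ℕ+, n = (p : ℕ) :=
  ⟨⟨n.toNat, by omega⟩, by simp; omega⟩

theorem pnat_of_neg {n : ℤ} (hn : n < 0) : ∃ p : ℕ+, n = -((p : ℕ) : ℤ) := by
  obtain ⟨p, hp⟩ := pnat_of_pos (n := -n) (by omega)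
  exact ⟨p, by omega⟩

theorem mode_nonneg_one {n : ℤ} (hn : 0 ≤ n) (a : h) : mode B n a 1 = 0 := by
  rcases hn.eq_or_lt with rfl | hn
  · simp
  · obtain ⟨p, rfl⟩ := pnat_of_pos hn
    exact mode_pnat_one B p a

/-- Both operators kill 𝟏, and the bracket of either with left multiplication by a letter is a
scalar, so the contraction terms produced in the two orders agree. -/
theorem mode_pnat_commute (n l : ℕ+) (a b : h) (w : TMinus h) :
    mode B (n : ℕ) a (mode B (l : ℕ) b w) = mode B (l : ℕ) b (mode B (n : ℕ) a w) := by
  induction w using TMinus.induction with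
  | one => simp [mode_pnat_one]
  | add u v hu hv => simp only [map_add, hu, hv]
  | smul c u hu => simp only [map_smul, hu]
  | letter_mul m c u hu =>
    simp only [mode_pnat_letter_mul, map_add, map_smul, hu]
    abel

theorem mode_nonneg_commute {n l : ℤ} (hn : 0 ≤ n) (hl : 0 ≤ l) (a b : h) :
    Commute (mode B n a) (mode B l b) := by
  rcases hn.eq_or_lt with rfl | hn
  · simp
  rcases hl.eq_or_lt with rfl | hl
  · simp
  obtain ⟨p, rfl⟩ := pnat_of_pos hn
  obtain ⟨q, rfl⟩ := pnat_of_pos hl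
  exact LinearMap.ext fun w => mode_pnat_commute B p q a b w

/-- A positive mode a(n) lowers the weight filtration by n, and the filtration is zero in negative
degree. The bound does not depend on a. -/
theorem exists_mode_eq_zero (v : TMinus h) : ∃ M : ℕ, ∀ (a : h) (n : ℤ), M < n →
    mode B n a v = 0 := by
  obtain ⟨K, hK⟩ := mem_weightLE v
  refine ⟨K.toNat, fun a n hn => ?_⟩
  have := mode_pos_mem B (n := n) (by omega) a hK
  rwa [weightLE_neg (by omega), Submodule.mem_bot] at this

theorem normalOrder_cons_neg {k : ℕ} {n : ℤ} (hn : n < 0) (n' : Fin k → ℤ) (a : h)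
    (a' : Fin k → h) :
    normalOrder B (Fin.cons n n' : Fin (k + 1) → ℤ) (Fin.cons a a' : Fin (k + 1) → h) =
      mode B n a * normalOrder B n' a' := by
  simp [normalOrder, List.finRange_succ, List.filter_map, Function.comp_def, hn, hn.ne,
    hn.le]

/-- Normal ordering puts the new mode at the head of the positive or of the zero group. Since
nonnegative modes commute, it can be carried through the rest of both groups to the far right. -/
theorem normalOrder_cons_nonneg {k : ℕ} {n : ℤ} (hn : 0 ≤ n) (n' : Fin k → ℤ) (a : h)
    (a' : Fin k → h) :
    normalOrder B (Fin.cons n n' : Fin (k + 1) → ℤ) (Fin.cons a a' : Fin (k + 1) → h) =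
      normalOrder B n' a' * mode B n a := by
  have hc : ∀ l : List (Fin k), (∀ i ∈ l, 0 ≤ n' i) →
      Commute (mode B n a) (l.map fun i => mode B (n' i) (a' i)).prod := by
    intro l hl
    refine Commute.list_prod_right _ _ fun x hx => ?_
    obtain ⟨i, hi, rfl⟩ := List.mem_map.1 hx
    exact mode_nonneg_commute B hn (hl i hi) a (a' i)
  have h1 := hc ((List.finRange k).filter (fun i => 0 < n' i)) (by simp; omega)
  have h2 := hc ((List.finRange k).filter (fun i => n' i = 0)) (by simp; omega)
  rcases hn.eq_or_lt with rfl | hn'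
  · simp [normalOrder, List.finRange_succ, List.filter_map, Function.comp_def]
  · simp only [normalOrder, List.finRange_succ, List.filter_map, Function.comp_def,
      List.filter_cons, Fin.cons_zero, Fin.cons_succ, decide_eq_true_eq, hn', not_lt.2 hn,
      hn'.ne', if_true, if_false, List.map_append, List.map_cons, List.map_map, List.prod_append,
      List.prod_cons]
    simp only [mul_assoc]
    rw [← h2.eq, ← mul_assoc (mode B n a), h1.eq, mul_assoc]

/-- The contribution of the mode `a(n)` to the coefficient of `x ^ N` in
`Y(a(-m)u, x)v`, see `vertexOperatorMap_letter_mul`. -/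
noncomputable def modeTerm (u : TMinus h) (a : h) (K : ℤ) (v : TMinus h) (n : ℤ) : TMinus h :=
  if n < 0 then mode B n a (vertexOperatorMap B u K v)
  else vertexOperatorMap B u K (mode B n a v)

theorem modeTerm_add (u u' : TMinus h) (a : h) (K : ℤ) (v : TMinus h) (n : ℤ) :
    modeTerm B (u + u') a K v n = modeTerm B u a K v n + modeTerm B u' a K v n := by
  simp only [modeTerm]
  split_ifs <;> simp

theorem modeTerm_smul (c : ℂ) (u : TMinus h) (a : h) (K : ℤ) (v : TMinus h) (n : ℤ) :
    modeTerm B (c • u) a K v n = c • modeTerm B u a K v n := by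
  simp only [modeTerm]
  split_ifs <;> simp

theorem vertexOperatorMap_one (N : ℤ) :
    vertexOperatorMap B (1 : TMinus h) N = if N = 0 then 1 else 0 := by
  refine LinearMap.ext fun v => ?_
  rw [← word_zero (h := h) Fin.elim0 Fin.elim0,
    (isVertexOperatorMap_vertexOperatorMap B 0 _ _ N v).2]
  have : ∀ n : Fin 0 → ℤ, vertexTerm B Fin.elim0 Fin.elim0 N v n =
      if N = 0 then v else 0 := by
    intro n
    simp [vertexTerm, normalOrder, eq_comm]
  rw [finsum_congr this, finsum_eq_single _ Fin.elim0 fun n hn =>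
    absurd (Subsingleton.elim _ _) hn]
  split_ifs <;> simp

theorem hasFinsum_vertexTerm {k : ℕ} (m : Fin k → ℕ+) (a : Fin k → h) (N : ℤ) (v : TMinus h) :
    HasFinsum (vertexTerm B m a N v) (vertexOperatorMap B (word m a) N v) :=
  ⟨(isVertexOperatorMap_vertexOperatorMap B k m a N v).1,
    (isVertexOperatorMap_vertexOperatorMap B k m a N v).2.symm⟩

/-- The mode a(n) of the divided derivative carries x^(-n-m), so the remaining factors must supply
the exponent N + n + m. -/
theorem vertexTerm_cons {k : ℕ} (m : ℕ+) (m' : Fin k → ℕ+) (a : h) (a' : Fin k → h) (N : ℤ)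
    (v : TMinus h) (n : ℤ) (n' : Fin k → ℤ) :
    vertexTerm B (Fin.cons m m' : Fin (k + 1) → ℕ+) (Fin.cons a a' : Fin (k + 1) → h) N v
      (Fin.cons n n' : Fin (k + 1) → ℤ) =
      derivCoeff m n • if n < 0 then mode B n a (vertexTerm B m' a' (N + n + (m : ℕ)) v n')
        else vertexTerm B m' a' (N + n + (m : ℕ)) (mode B n a v) n' := by
  simp only [vertexTerm, Fin.sum_univ_succ, Fin.cons_zero, Fin.cons_succ, Fin.prod_univ_succ]
  have hc : (-n - ((m : ℕ) : ℤ) + ∑ i, (-n' i - ((m' i : ℕ) : ℤ)) = N) ↔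
      ∑ i, (-n' i - ((m' i : ℕ) : ℤ)) = N + n + (m : ℕ) := by omega
  simp only [hc]
  split_ifs with h1 h2 h2
  · rw [normalOrder_cons_neg B h2, mul_smul, End.mul_apply, map_smul]
  · rw [normalOrder_cons_nonneg B (not_lt.1 h2), mul_smul, End.mul_apply]
  · simp
  · simp

/-- `Y(a(-m)u, x)v = a⁻(x)Y(u, x)v + Y(u, x)a⁺(x)v`, where `a⁻(x)` and `a⁺(x)` are the parts
with negative and nonnegative modes of the `(m-1)`-st divided derivative of `a(x)`. -/
theorem vertexOperatorMap_letter_mul (m : ℕ+) (a : h) (u : TMinus h) (N : ℤ) (v : TMinus h) :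
    HasFinsum (fun n : ℤ => derivCoeff m n • modeTerm B u a (N + n + (m : ℕ)) v n)
      (vertexOperatorMap B (letter m a * u) N v) := by
  have hu : u ∈ Submodule.span ℂ
      {w : TMinus h | ∃ (k : ℕ) (m : Fin k → ℕ+) (a : Fin k → h), w = word m a} := by
    rw [span_words]; trivial
  induction hu using Submodule.span_induction with
  | mem x hx =>
    obtain ⟨k, m', a', rfl⟩ := hx
    rw [letter_mul_word]
    -- On a word the sum over (n, n') is finite; summing over n' first turns the remaining factors
    -- into the vertex operator of the shorter word.
    have H := (hasFinsum_vertexTerm B (Fin.cons m m' : Fin (k + 1) → ℕ+)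
      (Fin.cons a a' : Fin (k + 1) → h) N v).comp_equiv (Fin.consEquiv fun _ => ℤ)
    refine HasFinsum.curry H fun n => ?_
    have hn : ∀ n' : Fin k → ℤ, Fin.consEquiv (fun _ => ℤ) (n, n') =
      (Fin.cons n n' : Fin (k + 1) → ℤ) := fun _ => rfl
    simp only [hn, vertexTerm_cons, modeTerm]
    split_ifs
    · exact ((hasFinsum_vertexTerm B m' a' _ v).map_linear (mode B n a)).smul _
    · exact (hasFinsum_vertexTerm B m' a' _ _).smul _
  | zero =>
    have : ∀ K n, modeTerm B 0 a K v n = 0 := fun K n => by simp [modeTerm]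
    simpa [this] using hasFinsum_zero
  | add x y _ _ hx hy =>
    simpa only [modeTerm_add, smul_add, mul_add, map_add, Pi.add_apply, LinearMap.add_apply]
      using hx.add hy
  | smul c x _ hx =>
    simpa only [modeTerm_smul, mul_smul_comm, map_smul, Pi.smul_apply, LinearMap.smul_apply,
      smul_comm c] using hx.smul c

end Recursion

/-! ### Binomial identities for the coefficients of divided derivatives -/

section Coefficients

theorem natPred_cast (m : ℕ+) : ((m.natPred : ℕ) : ℤ) = (m : ℕ) - 1 := by
  have := PNat.natPred_add_one m
  omega

theorem derivCoeff_neg (m p : ℕ+) :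
    derivCoeff m (-(p : ℕ)) = (Nat.choose p.natPred m.natPred : ℂ) := by
  have : (-(-((p : ℕ) : ℤ)) - 1) = (p.natPred : ℕ) := by rw [natPred_cast]; ring
  rw [derivCoeff, this, Ring.choose_natCast]
  simp

/-- The powers x⁰, …, x^(m-2) are killed by the (m-1)-st derivative. -/
theorem derivCoeff_eq_zero {m : ℕ+} {n : ℤ} (h1 : n < 0) (h2 : -(m : ℕ) < n) :
    derivCoeff m n = 0 := by
  obtain ⟨p, rfl⟩ := pnat_of_neg h1
  rw [derivCoeff_neg, Nat.choose_eq_zero_of_lt, Nat.cast_zero]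
  have h1 := PNat.natPred_add_one m
  have h2 := PNat.natPred_add_one p
  omega

theorem derivCoeff_neg_self (m : ℕ+) : derivCoeff m (-(m : ℕ)) = 1 := by
  rw [derivCoeff_neg, Nat.choose_self, Nat.cast_one]

theorem choose_succ_mul (r : ℤ) (k : ℕ) :
    ((k : ℤ) + 1) * Ring.choose r (k + 1) = Ring.choose r k * (r - k) := by
  have := Ring.choose_smul_choose r (Nat.le_succ k)
  simpa using this

theorem mul_choose_pred (r : ℤ) (k : ℕ) :
    r * Ring.choose (r - 1) k = Ring.choose r k * (r - k) := by
  have := Ring.choose_smul_choose r (n := k + 1) (k := 1) (by omega)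
  rw [← choose_succ_mul]
  simpa using this.symm

theorem natPred_add_one' (m : ℕ+) : (m + 1).natPred = m.natPred + 1 := by
  have h1 := PNat.natPred_add_one m
  have h2 := PNat.natPred_add_one (m + 1)
  rw [PNat.add_coe, PNat.one_coe] at h2
  omega

/-- Differentiating the m-th divided derivative once more yields m times the next one; here this is
compared on x^(-n-1). -/
theorem mul_derivCoeff_succ (m : ℕ+) (n : ℤ) :
    ((m : ℕ) : ℂ) * derivCoeff (m + 1) n = derivCoeff m n * (-n - (m : ℕ)) := by
  have h1 := choose_succ_mul (-n - 1) m.natPred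
  rw [natPred_cast] at h1
  have h2 := congrArg (Int.cast : ℤ → ℂ) h1
  rw [derivCoeff, derivCoeff, natPred_add_one']
  push_cast at h2 ⊢
  linear_combination h2

/-- The derivative may be taken before or after the divided derivative. Taking it first replaces
x^(-n-1) by (-n-1) x^(-n-2), which is the power attached to the mode n + 1. -/
theorem mul_derivCoeff_add_one (m : ℕ+) (n : ℤ) :
    (-n - 1 : ℂ) * derivCoeff m (n + 1) = derivCoeff m n * (-n - (m : ℕ)) := by
  have h1 := mul_choose_pred (-n - 1) m.natPred
  rw [natPred_cast] at h1
  have h2 := congrArg (Int.cast : ℤ → ℂ) h1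
  rw [derivCoeff, derivCoeff, show -(n + 1) - 1 = -n - 1 - 1 by ring]
  push_cast at h2 ⊢
  linear_combination h2

theorem derivCoeff_neg_mul (m n : ℕ+) :
    derivCoeff m (-(n : ℕ)) * (n : ℕ) = Nat.choose n m * (m : ℕ) := by
  rw [derivCoeff_neg]
  have := Nat.add_one_mul_choose_eq n.natPred m.natPred
  rw [PNat.natPred_add_one, PNat.natPred_add_one] at this
  rw [mul_comm]
  exact_mod_cast this

end Coefficients

/-! ### The creation property -/

section Creation

variable (B : LinearMap.BilinForm ℂ h)

/-- Acting on 𝟏, the nonnegative modes vanish, the modes with -m < n < 0 have coefficient zero, and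
the modes n < -m meet a negative coefficient of Y(u, x)𝟏. Only n = -m remains at exponent 0, and
nothing at negative exponents. Both claims are proved together because the induction uses both. -/
theorem creation_aux (u : TMinus h) :
    (∀ n : ℤ, n < 0 → vertexOperatorMap B u n 1 = 0) ∧ vertexOperatorMap B u 0 1 = u := by
  induction u using TMinus.induction with
  | one =>
    refine ⟨fun n hn => ?_, ?_⟩
    · simp [vertexOperatorMap_one, hn.ne]
    · simp [vertexOperatorMap_one]
  | add u v hu hv =>
    refine ⟨fun n hn => ?_, ?_⟩
    · simp [hu.1 n hn, hv.1 n hn]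
    · simp [hu.2, hv.2]
  | smul c u hu =>
    refine ⟨fun n hn => ?_, ?_⟩
    · simp [hu.1 n hn]
    · simp [hu.2]
  | letter_mul m a u hu =>
    have key : ∀ N : ℤ, N ≤ 0 → ∀ n : ℤ, (N = 0 → n ≠ -(m : ℕ)) →
        derivCoeff m n • modeTerm B u a (N + n + (m : ℕ)) 1 n = 0 := by
      intro N hN n hn
      rw [modeTerm]
      split_ifs with h0
      · rcases lt_or_ge (N + n + (m : ℕ)) 0 with h1 | h1
        · rw [hu.1 _ h1, map_zero, smul_zero]
        · rw [derivCoeff_eq_zero h0 (by by_contra; exact hn (by omega) (by omega)), zero_smul]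
      · rw [mode_nonneg_one B (not_lt.1 h0), map_zero, smul_zero]
    refine ⟨fun N hN => ?_, ?_⟩
    · have H := vertexOperatorMap_letter_mul B m a u N 1
      rw [← H.2]
      exact finsum_eq_zero_of_forall_eq_zero fun n => key N hN.le n (by omega)
    · have H := vertexOperatorMap_letter_mul B m a u 0 1
      refine H.unique ?_
      have := hasFinsum_single (f := fun n : ℤ =>
        derivCoeff m n • modeTerm B u a (0 + n + (m : ℕ)) 1 n) (-(m : ℕ))
        fun n hn => key 0 le_rfl n fun _ => hn
      have hm : -((m : ℕ) : ℤ) < 0 := by have := m.pos; omega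
      simpa only [derivCoeff_neg_self, modeTerm, if_pos hm, zero_add, neg_add_cancel, hu.2,
        mode_neg, one_smul] using this

theorem vertexOperatorMap_neg_one (u : TMinus h) {n : ℤ} (hn : n < 0) :
    vertexOperatorMap B u n 1 = 0 := (creation_aux B u).1 n hn

theorem vertexOperatorMap_zero_one (u : TMinus h) : vertexOperatorMap B u 0 1 = u :=
  (creation_aux B u).2

end Creation

/-! ### The translation operator D -/

section Translation

variable (B : LinearMap.BilinForm ℂ h)

/-- The operator `D` of `T(ĥ₋)`, as a linear map. -/
noncomputable def translation : End ℂ (TMinus h) where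
  toFun u := vertexOperatorMap B u 1 1
  map_add' u v := by simp
  map_smul' c u := by simp

theorem translationOperator_eq (u : TMinus h) :
    translationOperator (vertexOperatorMap B) 1 u = translation B u := by
  simp [translationOperator, FormalDist.deriv, translation]

theorem translation_one : translation B (1 : TMinus h) = 0 := by
  simp [translation, vertexOperatorMap_one]

/-- This is Leibniz's rule with D a(-m)𝟏 = m a(-m-1)𝟏. At exponent 1 exactly two modes survive on 𝟏:
n = -m-1 meets the constant term u, and n = -m meets the linear term Du. -/
theorem translation_letter_mul (m : ℕ+) (a : h) (u : TMinus h) :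
    translation B (letter m a * u) =
      ((m : ℕ) : ℂ) • (letter (m + 1) a * u) + letter m a * translation B u := by
  have H := vertexOperatorMap_letter_mul B m a u 1 1
  have h1 := (hasFinsum_single (f := fun n : ℤ => if n = -((m + 1 : ℕ+) : ℕ) then
    ((m : ℕ) : ℂ) • (letter (m + 1) a * u) else 0) (-((m + 1 : ℕ+) : ℕ))
    fun n hn => if_neg hn).add
    (hasFinsum_single (f := fun n : ℤ => if n = -(m : ℕ) then letter m a * translation B u else 0)
      (-(m : ℕ)) fun n hn => if_neg hn)
  simp only [if_true] at h1
  refine H.unique (?_ : HasFinsum _ _)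
  refine (congrArg (fun f => HasFinsum f _) (funext fun n => ?_)).mp h1
  have hm := m.pos
  have hc : ((m + 1 : ℕ+) : ℕ) = (m : ℕ) + 1 := rfl
  rw [hc, modeTerm]
  rcases lt_or_ge n 0 with h0 | h0
  · rw [if_pos h0]
    by_cases e1 : n = -((m : ℕ) + 1 : ℕ)
    · have h3 := mode_neg B (m + 1) a u
      -- The value m is (m choose m-1), obtained by cancelling m + 1 from the absorption identity.
      have hd : derivCoeff m n = (m : ℕ) := by
        have h4 := derivCoeff_neg_mul m (m + 1)
        rw [hc, ← e1, Nat.choose_succ_self_right] at h4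
        have : (((m : ℕ) + 1 : ℕ) : ℂ) ≠ 0 := Nat.cast_ne_zero.2 (by omega)
        apply mul_right_cancel₀ this
        rw [h4, mul_comm]
      rw [if_pos e1, if_neg (by omega), hd, add_zero,
        show (1 : ℤ) + n + (m : ℕ) = 0 by omega, vertexOperatorMap_zero_one, ← h3, hc, e1]
    · rw [if_neg e1, zero_add]
      by_cases e2 : n = -(m : ℕ)
      · rw [if_pos e2, e2, derivCoeff_neg_self, one_smul, mode_neg,
          show (1 : ℤ) + -(m : ℕ) + (m : ℕ) = 1 by omega]
        rfl
      · rw [if_neg e2]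
        rcases lt_or_ge n (-(m : ℕ)) with h2 | h2
        · rw [vertexOperatorMap_neg_one B u (by omega), map_zero, smul_zero]
        · rw [derivCoeff_eq_zero h0 (by omega), zero_smul]
  · rw [if_neg (not_lt.2 h0), mode_nonneg_one B h0, map_zero, smul_zero, if_neg (by omega),
      if_neg (by omega), add_zero]

theorem mode_nonneg_letter_mul {n : ℤ} (hn : 0 ≤ n) (m : ℕ+) (a b : h) (w : TMinus h) :
    mode B n a (letter m b * w) = letter m b * mode B n a w +
      (if n = (m : ℕ) then (n : ℂ) * B a b else 0) • w := by
  rcases hn.eq_or_lt with rfl | hn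
  · simp
  · obtain ⟨p, rfl⟩ := pnat_of_pos hn
    rw [mode_pnat_letter_mul]
    simp [← PNat.coe_inj]

/-- For n < 0 this is Leibniz's rule for a letter. For n > 0 both sides vanish on 𝟏, and in the
induction the letter b(-m-1) created by D is contracted by a(n) precisely when a(n-1) contracts
b(-m). -/
theorem translation_mode (n : ℤ) (a : h) (v : TMinus h) :
    translation B (mode B n a v) =
      mode B n a (translation B v) - (n : ℂ) • mode B (n - 1) a v := by
  rcases lt_trichotomy n 0 with hn | rfl | hn
  · obtain ⟨p, rfl⟩ := pnat_of_neg hn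
    rw [mode_neg, translation_letter_mul, mode_neg,
      show -((p : ℕ) : ℤ) - 1 = -((p + 1 : ℕ+) : ℕ) by rw [PNat.add_coe]; push_cast; ring, mode_neg]
    push_cast
    module
  · simp
  · induction v using TMinus.induction with
    | one =>
      rw [mode_nonneg_one B hn.le, translation_one, mode_nonneg_one B (by omega)]
      simp
    | add u v hu hv => simp only [map_add, hu, hv]; module
    | smul c u hu => simp only [map_smul, hu]; module
    | letter_mul m b u hu =>
      have h1 : (0 : ℤ) ≤ n - 1 := by omega
      simp only [mode_nonneg_letter_mul B hn.le, mode_nonneg_letter_mul B h1, map_add, map_smul,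
        translation_letter_mul, hu, PNat.add_coe, PNat.one_coe, mul_sub, mul_smul_comm]
      have hc : n = (((m : ℕ) + 1 : ℕ) : ℤ) ↔ n - 1 = (m : ℕ) := by push_cast; omega
      by_cases h2 : n - 1 = (m : ℕ)
      · have h3 : ((m : ℕ) : ℂ) = n - 1 := by
          have := congrArg (Int.cast : ℤ → ℂ) h2
          push_cast at this
          exact this.symm
        simp only [hc, if_pos h2, h3]
        push_cast
        module
      · simp only [hc, if_neg h2]
        module

/-- The product rule for the recursion: D either raises the first letter, which differentiates a(x)
once more, or acts on u, where the induction hypothesis applies. -/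
theorem deriv_vertexOperatorMap (u : TMinus h) (N : ℤ) (v : TMinus h) :
    ((N : ℂ) + 1) • vertexOperatorMap B u (N + 1) v =
      vertexOperatorMap B (translation B u) N v := by
  induction u using TMinus.induction generalizing N v with
  | one =>
    rw [translation_one, vertexOperatorMap_one]
    by_cases hN : N + 1 = 0
    · have : (N : ℂ) + 1 = 0 := by exact_mod_cast hN
      simp [this]
    · simp [hN]
  | add u u' hu hu' => simp [smul_add, hu, hu']
  | smul c u hu => simp [hu, smul_comm _ c]
  | letter_mul m a u hu =>
    have H1 := (vertexOperatorMap_letter_mul B m a u (N + 1) v).smul ((N : ℂ) + 1)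
    have H2 := ((vertexOperatorMap_letter_mul B (m + 1) a u N v).smul (m : ℕ)).add
      (vertexOperatorMap_letter_mul B m a (translation B u) N v)
    rw [translation_letter_mul, map_add, map_smul]
    simp only [Pi.add_apply, Pi.smul_apply, LinearMap.add_apply, LinearMap.smul_apply]
    refine H1.unique ((congrArg (fun f => HasFinsum f _) (funext fun n => ?_)).mp H2)
    have hT : modeTerm B (translation B u) a (N + n + (m : ℕ)) v n =
        ((N : ℂ) + n + (m : ℕ) + 1) • modeTerm B u a (N + 1 + n + (m : ℕ)) v n := by
      have e : N + 1 + n + ((m : ℕ) : ℤ) = N + n + (m : ℕ) + 1 := by ring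
      rw [e]
      simp only [modeTerm, ← hu]
      push_cast
      split_ifs
      · rw [map_smul]
      · rfl
    have e2 : N + n + (((m + 1 : ℕ+) : ℕ) : ℤ) = N + 1 + n + (m : ℕ) := by
      rw [PNat.add_coe, PNat.one_coe]; push_cast; ring
    rw [hT, e2]
    simp only [smul_smul, ← add_smul]
    congr 1
    linear_combination mul_derivCoeff_succ m n

/-- In the recursion, [D, a(n)] = -n a(n-1) and the induction hypothesis for u split the commutator
with D into two sums, one over T(n) and one over T(n-1). Reindexing the second recovers the
derivative. -/
theorem translation_vertexOperatorMap (u : TMinus h) (N : ℤ) (v : TMinus h) :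
    ((N : ℂ) + 1) • vertexOperatorMap B u (N + 1) v =
      translation B (vertexOperatorMap B u N v) - vertexOperatorMap B u N (translation B v) := by
  induction u using TMinus.induction generalizing N v with
  | one =>
    rw [vertexOperatorMap_one, vertexOperatorMap_one]
    by_cases hN : N + 1 = 0
    · have h1 : (N : ℂ) + 1 = 0 := by exact_mod_cast hN
      have h2 : N ≠ 0 := by omega
      simp [h1, h2]
    · by_cases h2 : N = 0 <;> simp [hN, h2]
  | add u u' hu hu' =>
    simp only [map_add, Pi.add_apply, LinearMap.add_apply, smul_add, hu, hu']
    abel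
  | smul c u hu =>
    simp only [map_smul, Pi.smul_apply, LinearMap.smul_apply, smul_comm _ c, hu, smul_sub]
  | letter_mul m a u hu =>
    have H1 := (vertexOperatorMap_letter_mul B m a u (N + 1) v).smul ((N : ℂ) + 1)
    have H2 := ((vertexOperatorMap_letter_mul B m a u N v).map_linear (translation B)).sub
      (vertexOperatorMap_letter_mul B m a u N (translation B v))
    set T : ℤ → TMinus h := fun n => modeTerm B u a (N + 1 + n + (m : ℕ)) v n with hT
    have key : ∀ n : ℤ,
        translation B (derivCoeff m n • modeTerm B u a (N + n + (m : ℕ)) v n) -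
          derivCoeff m n • modeTerm B u a (N + n + (m : ℕ)) (translation B v) n =
        (derivCoeff m n * ((N : ℂ) + n + (m : ℕ) + 1)) • T n -
          ((n : ℂ) * derivCoeff m n) • T (n - 1) := by
      intro n
      have e : N + 1 + n + ((m : ℕ) : ℤ) = N + n + (m : ℕ) + 1 := by ring
      have e' : N + 1 + (n - 1) + ((m : ℕ) : ℤ) = N + n + (m : ℕ) := by ring
      have hu' := hu (N + n + (m : ℕ))
      push_cast at hu'
      simp only [hT, modeTerm, e, e', map_smul]
      rcases lt_trichotomy n 0 with hn | rfl | hn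
      · have hv := congrArg (mode B n a) (hu' v)
        rw [map_smul, map_sub] at hv
        rw [if_pos hn, if_pos hn, if_pos hn, if_pos (by omega), translation_mode,
          mul_smul, hv]
        module
      -- At n = 0 the term T(n) is an annihilation term and T(n-1) a creation term; the mismatch is
      -- harmless since a(0) = 0 and T(n-1) has coefficient 0.
      · simp
      · rw [if_neg (by omega), if_neg (by omega), if_neg (by omega), if_neg (by omega),
          mul_smul, hu' (mode B n a v), translation_mode, map_sub, map_smul]
        module
    simp only [key] at H2
    set G : ℤ → TMinus h := fun n => ((n : ℂ) * derivCoeff m n) • T (n - 1) with hG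
    set F : ℤ → TMinus h := fun n => (derivCoeff m n * ((N : ℂ) + n + (m : ℕ) + 1)) • T n with hF
    have hTfin : HasFinsum (fun n => derivCoeff m n • T n)
      (vertexOperatorMap B (letter m a * u) (N + 1) v) :=
      vertexOperatorMap_letter_mul B m a u (N + 1) v
    have hFfin : HasFinsum F (∑ᶠ n, F n) := by
      refine ⟨hTfin.1.subset fun n hn => ?_, rfl⟩
      rw [Function.mem_support] at hn ⊢
      intro H
      apply hn
      rw [hF]
      simp only
      rw [mul_comm, mul_smul, H, smul_zero]
    -- Finite support of G is inherited from G = F - (F - G), where F - G is the known family for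
    -- the commutator.
    have hGfin : HasFinsum G (∑ᶠ n, F n - (translation B (vertexOperatorMap B (letter m a * u) N v)
        - vertexOperatorMap B (letter m a * u) N (translation B v))) := by
      have := hFfin.sub H2
      refine (congrArg (fun f => HasFinsum f _) (funext fun n => ?_)).mp this
      exact sub_sub_cancel _ _
    -- Replacing n by n + 1 turns T(n-1) into T(n), so the two coefficients can be compared.
    have hG' := hGfin.comp_equiv (Equiv.addRight (1 : ℤ))
    have H3 := hFfin.sub hG'
    rw [sub_sub_cancel] at H3
    refine H1.unique ((congrArg (fun f => HasFinsum f _) (funext fun n => ?_)).mp H3)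
    simp only [hF, hG, Equiv.coe_addRight, add_sub_cancel_right, smul_smul, ← sub_smul]
    change _ = ((↑N + 1) * derivCoeff m n) • T n
    congr 1
    push_cast
    linear_combination mul_derivCoeff_add_one m n

end Translation

/-! ### The weight grading and the operator d -/

section GradingOperator

variable {V : Type*} [AddCommGroup V] [Module ℂ V]

theorem gradingOperator_apply {gr : ℤ → Submodule ℂ V} (hgr : DirectSum.IsInternal gr) {n : ℤ}
    {w : V} (hw : w ∈ gr n) : gradingOperator gr hgr w = (n : ℂ) • w := by
  have h1 : (LinearEquiv.ofBijective (DirectSum.coeLinearMap gr) hgr).symm w =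
      DirectSum.lof ℂ ℤ (fun n => gr n) n ⟨w, hw⟩ := by
    rw [LinearEquiv.symm_apply_eq]
    exact (DirectSum.coeLinearMap_lof gr n ⟨w, hw⟩).symm
  rw [gradingOperator, LinearMap.comp_apply, LinearEquiv.coe_coe, h1, DirectSum.toModule_lof]
  simp

end GradingOperator

section Grading

theorem word_succ {k : ℕ} (m : Fin (k + 1) → ℕ+) (a : Fin (k + 1) → h) :
    word m a = letter (m 0) (a 0) * word (Fin.tail m) (Fin.tail a) := by
  simp [word, List.ofFn_succ, Fin.tail]

theorem letter_mul_mem_weightSpace {n : ℤ} {w : TMinus h} (m : ℕ+) (a : h)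
    (hw : w ∈ weightSpace h n) : letter m a * w ∈ weightSpace h (n + (m : ℕ)) := by
  induction hw using Submodule.span_induction with
  | mem x hx =>
    obtain ⟨k, m', a', hs, rfl⟩ := hx
    refine Submodule.subset_span ⟨k + 1, _, _, ?_, letter_mul_word m a m' a'⟩
    simp only [Fin.sum_univ_succ, Fin.cons_zero, Fin.cons_succ, hs]
    ring
  | zero => simp
  | add x y _ _ hx hy => rw [mul_add]; exact add_mem hx hy
  | smul c x _ hx => rw [mul_smul_comm]; exact Submodule.smul_mem _ c hx

theorem one_mem_weightSpace : (1 : TMinus h) ∈ weightSpace h 0 :=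
  Submodule.subset_span ⟨0, Fin.elim0, Fin.elim0, by simp, (word_zero _ _).symm⟩

theorem iSup_weightSpace : ⨆ n, weightSpace h n = ⊤ := by
  rw [eq_top_iff]
  rintro u -
  induction u using TMinus.induction with
  | one => exact Submodule.mem_iSup_of_mem 0 one_mem_weightSpace
  | add u v hu hv => exact add_mem hu hv
  | smul c u hu => exact Submodule.smul_mem _ c hu
  | letter_mul m a u hu =>
    induction hu using Submodule.iSup_induction' with
    | mem n x hx => exact Submodule.mem_iSup_of_mem _ (letter_mul_mem_weightSpace m a hx)
    | zero => simp
    | add x y _ _ hx hy => rw [mul_add]; exact add_mem hx hy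

theorem TMinus.induction_homogeneous {P : TMinus h → Prop}
    (mem : ∀ (n : ℤ), ∀ u ∈ weightSpace h n, P u) (add : ∀ u v, P u → P v → P (u + v))
    (u : TMinus h) : P u := by
  have hu : u ∈ ⨆ n, weightSpace h n := by rw [iSup_weightSpace]; trivial
  induction hu using Submodule.iSup_induction' with
  | mem n x hx => exact mem n x hx
  | zero => exact mem 0 0 (zero_mem _)
  | add x y _ _ hx hy => exact add x y hx hy

variable (h) in
/-- The automorphism of `T(ĥ₋)` which acts on the homogeneous subspace of weight `n` as
multiplication by `2 ^ n`. -/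
noncomputable def weightScaling : TMinus h →ₐ[ℂ] TMinus h :=
  TensorAlgebra.lift ℂ (TensorAlgebra.ι ℂ ∘ₗ
    Finsupp.lsum ℂ fun m : ℕ+ => (2 : ℂ) ^ (m : ℕ) • Finsupp.lsingle m)

theorem weightScaling_letter (m : ℕ+) (a : h) :
    weightScaling h (letter m a) = (2 : ℂ) ^ (m : ℕ) • letter m a := by
  rw [weightScaling, letter, LinearMap.comp_apply, TensorAlgebra.lift_ι_apply,
    LinearMap.comp_apply, Finsupp.lsingle_apply, Finsupp.lsum_single, LinearMap.smul_apply,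
    map_smul, Finsupp.lsingle_apply]

theorem weightScaling_word {k : ℕ} (m : Fin k → ℕ+) (a : Fin k → h) :
    weightScaling h (word m a) = (2 : ℂ) ^ (∑ i, ((m i : ℕ) : ℤ)) • word m a := by
  induction k with
  | zero => simp [word_zero]
  | succ k ih =>
    rw [word_succ, map_mul, ih, weightScaling_letter, Fin.sum_univ_succ, zpow_add₀ two_ne_zero,
      smul_mul_smul_comm, zpow_natCast]
    rfl

theorem weightSpace_le_eigenspace (n : ℤ) :
    weightSpace h n ≤ End.eigenspace (weightScaling h).toLinearMap ((2 : ℂ) ^ n) := by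
  refine Submodule.span_le.2 ?_
  rintro w ⟨k, m, a, hs, rfl⟩
  rw [SetLike.mem_coe, End.mem_eigenspace_iff, AlgHom.toLinearMap_apply, weightScaling_word, hs]

/-- The space of weight n lies in the eigenspace of `weightScaling` for 2 ^ n. Since 2 has infinite
order these eigenvalues are distinct, and eigenspaces for distinct eigenvalues are independent. -/
theorem isInternal_weightSpace : DirectSum.IsInternal (weightSpace h) := by
  refine DirectSum.isInternal_submodule_of_iSupIndep_of_iSup_eq_top ?_ iSup_weightSpace
  have hinj : Function.Injective fun n : ℤ => (2 : ℂ) ^ n := by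
    intro a b hab
    have h1 := congrArg norm hab
    simp only [norm_zpow, Complex.norm_ofNat] at h1
    exact zpow_right_injective₀ two_pos (by norm_num) h1
  exact ((End.eigenspaces_iSupIndep (weightScaling h).toLinearMap).comp hinj).mono
    weightSpace_le_eigenspace

theorem weightSpace_neg {n : ℤ} (hn : n < 0) : weightSpace h n = ⊥ := by
  rw [weightSpace, Submodule.span_eq_bot]
  rintro w ⟨k, m, a, hs, -⟩
  have : 0 ≤ ∑ i, ((m i : ℕ) : ℤ) := Finset.sum_nonneg fun _ _ => by positivity
  omega

/-- A nonempty word of weight n starts with a letter of weight p + 1 ≤ n, followed by a word of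
strictly smaller weight. So strong induction bounds the space by finitely many products of
finite-dimensional spaces, plus the line through 𝟏. -/
theorem finiteDimensional_weightSpace [FiniteDimensional ℂ h] (n : ℤ) :
    FiniteDimensional ℂ (weightSpace h n) := by
  rcases lt_or_ge n 0 with hn | hn
  · rw [weightSpace_neg hn]; infer_instance
  lift n to ℕ using hn
  induction n using Nat.strong_induction_on with
  | _ n ih =>
    have hle : weightSpace h n ≤ Submodule.span ℂ {1} ⊔ ⨆ p : Fin n,
        LinearMap.range (letter (h := h) (Nat.succPNat p)) *
          weightSpace h ((n - (p + 1) : ℕ) : ℤ) := by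
      refine Submodule.span_le.2 ?_
      rintro w ⟨k, m, a, hs, rfl⟩
      cases k with
      | zero =>
        rw [word_zero]
        exact Submodule.mem_sup_left (Submodule.subset_span rfl)
      | succ k =>
        rw [Fin.sum_univ_succ] at hs
        have h0 : 0 ≤ ∑ i : Fin k, ((m i.succ : ℕ) : ℤ) :=
          Finset.sum_nonneg fun _ _ => by positivity
        have h1 := PNat.natPred_add_one (m 0)
        refine Submodule.mem_sup_right (Submodule.mem_iSup_of_mem
          (⟨(m 0).natPred, by omega⟩ : Fin n) ?_)
        rw [word_succ]
        refine Submodule.mul_mem_mul ⟨a 0, by simp⟩ (Submodule.subset_span ⟨k, _, _, ?_, rfl⟩)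
        simp only [Fin.tail]
        omega
    have hfg : (Submodule.span ℂ {(1 : TMinus h)} ⊔ ⨆ p : Fin n,
        LinearMap.range (letter (h := h) (Nat.succPNat p)) *
          weightSpace h ((n - (p + 1) : ℕ) : ℤ)).FG := by
      refine (Submodule.fg_span_singleton _).sup (Submodule.fg_iSup _ fun p => ?_)
      exact (Module.Finite.iff_fg.1 inferInstance).mul
        (Module.Finite.iff_fg.1 (ih _ (by have := p.2; omega)))
    have := Module.Finite.iff_fg.2 hfg
    exact Submodule.finiteDimensional_of_le hle

theorem gradingOperator_one :
    gradingOperator (weightSpace h) isInternal_weightSpace 1 = 0 := by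
  rw [gradingOperator_apply _ one_mem_weightSpace]
  simp

theorem gradingOperator_letter_mul (m : ℕ+) (a : h) (u : TMinus h) :
    gradingOperator (weightSpace h) isInternal_weightSpace (letter m a * u) =
      ((m : ℕ) : ℂ) • (letter m a * u) +
        letter m a * gradingOperator (weightSpace h) isInternal_weightSpace u := by
  induction u using TMinus.induction_homogeneous with
  | mem n u hu =>
    rw [gradingOperator_apply _ hu, gradingOperator_apply _ (letter_mul_mem_weightSpace m a hu),
      mul_smul_comm]
    push_cast
    module
  | add u v hu hv => simp only [mul_add, map_add, hu, hv]; module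

theorem gradingOperator_mode (B : LinearMap.BilinForm ℂ h) (n : ℤ) (a : h) (v : TMinus h) :
    gradingOperator (weightSpace h) isInternal_weightSpace (mode B n a v) =
      mode B n a (gradingOperator (weightSpace h) isInternal_weightSpace v) -
        (n : ℂ) • mode B n a v := by
  rcases lt_or_ge n 0 with hn | hn
  · obtain ⟨p, rfl⟩ := pnat_of_neg hn
    rw [mode_neg, gradingOperator_letter_mul, mode_neg]
    push_cast
    module
  · induction v using TMinus.induction with
    | one => simp [mode_nonneg_one B hn, gradingOperator_one]
    | add u v hu hv => simp only [map_add, hu, hv]; module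
    | smul c u hu => simp only [map_smul, hu]; module
    | letter_mul m b u hu =>
      simp only [mode_nonneg_letter_mul B hn, map_add, map_smul, gradingOperator_letter_mul, hu,
        mul_sub, mul_smul_comm]
      split_ifs with h1
      · have h3 : (n : ℂ) = (m : ℕ) := by rw [h1]; push_cast; rfl
        rw [h3]
        module
      · module

/-- In the recursion the mode a(n) contributes -n, the letter contributes m, and the inner exponent
is N + n + m, so every term receives the same shift N. -/
theorem gradingOperator_vertexOperatorMap (B : LinearMap.BilinForm ℂ h) (u : TMinus h) (N : ℤ)
    (v : TMinus h) :
    gradingOperator (weightSpace h) isInternal_weightSpace (vertexOperatorMap B u N v) =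
      vertexOperatorMap B u N (gradingOperator (weightSpace h) isInternal_weightSpace v) +
      vertexOperatorMap B (gradingOperator (weightSpace h) isInternal_weightSpace u) N v +
      (N : ℂ) • vertexOperatorMap B u N v := by
  induction u using TMinus.induction generalizing N v with
  | one =>
    rw [gradingOperator_one, vertexOperatorMap_one]
    by_cases hN : N = 0 <;> simp [hN]
  | add u u' hu hu' =>
    simp only [map_add, Pi.add_apply, LinearMap.add_apply, hu, hu']
    module
  | smul c u hu =>
    simp only [map_smul, Pi.smul_apply, LinearMap.smul_apply, hu]
    module
  | letter_mul m a u hu =>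
    have H := vertexOperatorMap_letter_mul B m a u N v
    have H1 := H.map_linear (gradingOperator (weightSpace h) isInternal_weightSpace)
    have H2 := ((vertexOperatorMap_letter_mul B m a u N
      (gradingOperator (weightSpace h) isInternal_weightSpace v)).add
      ((H.smul (m : ℕ)).add (vertexOperatorMap_letter_mul B m a
        (gradingOperator (weightSpace h) isInternal_weightSpace u) N v))).add (H.smul N)
    rw [gradingOperator_letter_mul, map_add, map_smul]
    simp only [Pi.add_apply, Pi.smul_apply, LinearMap.add_apply, LinearMap.smul_apply]
    refine H1.unique ((congrArg (fun f => HasFinsum f _) (funext fun n => ?_)).mp H2)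
    have hu' := hu (N + n + (m : ℕ))
    push_cast at hu'
    simp only [map_smul, modeTerm]
    split_ifs
    · rw [gradingOperator_mode, hu', map_add, map_add, map_smul]
      module
    · rw [hu', gradingOperator_mode, map_sub, map_smul]
      module

end Grading

/-! ### Commutators of positive modes with vertex operators -/

section Commutator

variable (B : LinearMap.BilinForm ℂ h)

/-- The commutator formula `[a(n), Y(u, x)] = ∑ₚ (n choose p) x^(n-p) Y(a(p)u, x)` for `n > 0`. -/
theorem mode_vertexOperatorMap (n : ℕ+) (a : h) (u : TMinus h) (S : Finset ℕ+)
    (hS : ∀ p ≤ n, p ∈ S) (N : ℤ) (v : TMinus h) :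
    mode B (n : ℕ) a (vertexOperatorMap B u N v) =
      vertexOperatorMap B u N (mode B (n : ℕ) a v) +
        ∑ p ∈ S, (Nat.choose n p : ℂ) •
          vertexOperatorMap B (mode B (p : ℕ) a u) (N - (n : ℕ) + (p : ℕ)) v := by
  induction u using TMinus.induction generalizing N v with
  | one =>
    rw [vertexOperatorMap_one]
    by_cases hN : N = 0 <;> simp [hN, mode_pnat_one]
  | add u u' hu hu' =>
    simp only [map_add, Pi.add_apply, LinearMap.add_apply, hu, hu', smul_add,
      Finset.sum_add_distrib]
    abel
  | smul c u hu =>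
    simp only [map_smul, Pi.smul_apply, LinearMap.smul_apply, hu, smul_add, Finset.smul_sum,
      smul_comm c]
  | letter_mul m b u hu =>
    have H1 := (vertexOperatorMap_letter_mul B m b u N v).map_linear (mode B (n : ℕ) a)
    have H2 := vertexOperatorMap_letter_mul B m b u N (mode B (n : ℕ) a v)
    have H3 := HasFinsum.sum S fun p _ => (vertexOperatorMap_letter_mul B m b
      (mode B (p : ℕ) a u) (N - (n : ℕ) + (p : ℕ)) v).smul (Nat.choose n p : ℂ)
    -- Besides commutators with Y(u, x), moving a(n) through the recursion produces one extra term,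
    -- the contraction with the creation mode b(-n).
    have H4 := hasFinsum_single (f := fun l : ℤ => if l = -(n : ℕ) then
      derivCoeff m l • ((n : ℕ) * B a b : ℂ) • vertexOperatorMap B u (N + l + (m : ℕ)) v else 0)
      (-(n : ℕ)) fun l hl => if_neg hl
    simp only [if_true] at H4
    -- On the other side the extra term comes from a(p) contracting the first letter, so p = m. The
    -- coefficients agree by m (n choose m) = n (n-1 choose m-1); if m is not in S then n < m and
    -- both vanish.
    have hR : ∑ p ∈ S, (Nat.choose n p : ℂ) • vertexOperatorMap B
          (mode B (p : ℕ) a (letter m b * u)) (N - (n : ℕ) + (p : ℕ)) v =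
        ∑ p ∈ S, (Nat.choose n p : ℂ) • vertexOperatorMap B
          (letter m b * mode B (p : ℕ) a u) (N - (n : ℕ) + (p : ℕ)) v +
        derivCoeff m (-(n : ℕ)) • ((n : ℕ) * B a b : ℂ) •
          vertexOperatorMap B u (N + -(n : ℕ) + (m : ℕ)) v := by
      simp only [mode_pnat_letter_mul, map_add, map_smul, Pi.add_apply, Pi.smul_apply,
        LinearMap.add_apply, LinearMap.smul_apply, smul_add, Finset.sum_add_distrib]
      congr 1
      rw [smul_smul, ← mul_assoc, derivCoeff_neg_mul]
      by_cases hm : m ∈ S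
      · rw [Finset.sum_eq_single_of_mem m hm fun p _ hp => by simp [hp], if_pos rfl, smul_smul,
          mul_assoc, sub_eq_add_neg]
      · have : n < m := by
          by_contra H
          exact hm (hS m (not_lt.1 H))
        rw [Nat.choose_eq_zero_of_lt (by exact_mod_cast this), Nat.cast_zero, zero_mul, zero_mul,
          zero_smul]
        refine Finset.sum_eq_zero fun p hp => ?_
        rw [if_neg (by rintro rfl; exact hm hp), zero_smul, smul_zero]
    rw [hR]
    refine H1.unique ((congrArg₂ HasFinsum (funext fun l => ?_) (by abel)).mp ((H2.add H3).add H4))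
    have hK : ∀ p : ℕ+, N - (n : ℕ) + ((p : ℕ) : ℤ) + l + (m : ℕ) =
      N + l + (m : ℕ) - (n : ℕ) + (p : ℕ) := fun p => by ring
    simp only [hK, map_smul]
    have key : mode B (n : ℕ) a (modeTerm B u b (N + l + (m : ℕ)) v l) =
        modeTerm B u b (N + l + (m : ℕ)) (mode B (n : ℕ) a v) l +
        ∑ p ∈ S, (Nat.choose n p : ℂ) • modeTerm B (mode B (p : ℕ) a u) b
          (N + l + (m : ℕ) - (n : ℕ) + (p : ℕ)) v l +
        if l = -(n : ℕ) then
          ((n : ℕ) * B a b : ℂ) • vertexOperatorMap B u (N + l + (m : ℕ)) v else 0 := by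
      simp only [modeTerm]
      rcases lt_or_ge l 0 with hl | hl
      · obtain ⟨q, rfl⟩ := pnat_of_neg hl
        have hq : -((q : ℕ) : ℤ) = -((n : ℕ) : ℤ) ↔ n = q := by
          rw [neg_inj, Nat.cast_inj, PNat.coe_inj, eq_comm]
        simp only [if_pos hl, mode_neg, mode_pnat_letter_mul, hu, mul_add, Finset.mul_sum,
          mul_smul_comm, hq, ite_smul, zero_smul]
      · simp only [if_neg (not_lt.2 hl)]
        rw [hu, if_neg (by have := n.pos; omega), add_zero]
        congr 2
        exact DFunLike.congr_fun (mode_nonneg_commute B (by positivity) hl a b).eq v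
    rw [key, smul_add, smul_add, Finset.smul_sum]
    congr 1
    · congr 1
      exact Finset.sum_congr rfl fun p _ => smul_comm _ _ _
    · split_ifs <;> simp

end Commutator

/-! ### Absolutely convergent families -/

section AbsoluteConvergence

variable {ι κ E : Type*}

theorem ConvergesAbsolutelyTo.add {f g : ι → ℂ} {s t : ℂ} (hf : ConvergesAbsolutelyTo f s)
    (hg : ConvergesAbsolutelyTo g t) : ConvergesAbsolutelyTo (fun i => f i + g i) (s + t) :=
  ⟨(hf.1.add hg.1).of_nonneg_of_le (fun _ => norm_nonneg _) fun _ => norm_add_le _ _,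
    hf.2.add hg.2⟩

theorem ConvergesAbsolutelyTo.const_mul {f : ι → ℂ} {s : ℂ} (hf : ConvergesAbsolutelyTo f s)
    (c : ℂ) : ConvergesAbsolutelyTo (fun i => c * f i) (c * s) :=
  ⟨by simpa only [norm_mul] using hf.1.mul_left ‖c‖, hf.2.mul_left c⟩

theorem convergesAbsolutelyTo_zero : ConvergesAbsolutelyTo (fun _ : ι => (0 : ℂ)) 0 :=
  ⟨by simp, hasSum_zero⟩

theorem ConvergesAbsolutelyTo.sum {f : κ → ι → ℂ} {s : κ → ℂ} (S : Finset κ)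
    (hf : ∀ j ∈ S, ConvergesAbsolutelyTo (f j) (s j)) :
    ConvergesAbsolutelyTo (fun i => ∑ j ∈ S, f j i) (∑ j ∈ S, s j) := by
  classical
  induction S using Finset.induction_on with
  | empty => simpa using convergesAbsolutelyTo_zero
  | insert j S hj ih =>
    simp only [Finset.sum_insert hj]
    exact (hf j (by simp)).add (ih fun i hi => hf i (by simp [hi]))

theorem ConvergesAbsolutelyTo.of_eq {f g : ι → ℂ} {s t : ℂ} (hf : ConvergesAbsolutelyTo f s)
    (h : ∀ i, g i = f i) (hst : t = s) : ConvergesAbsolutelyTo g t := by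
  rw [funext h, hst]; exact hf

theorem convergesAbsolutelyTo_iff_of_injective {f : ι → ℂ} {s : ℂ} {g : κ → ι}
    (hg : Function.Injective g) (hf : ∀ i ∉ Set.range g, f i = 0) :
    ConvergesAbsolutelyTo (fun k => f (g k)) s ↔ ConvergesAbsolutelyTo f s :=
  and_congr (hg.summable_iff (f := fun i => ‖f i‖) fun i hi => by simp [hf i hi])
    (hg.hasSum_iff hf)

theorem ConvergesAbsolutelyTo.comp_equiv {f : ι → ℂ} {s : ℂ} (hf : ConvergesAbsolutelyTo f s)
    (e : κ ≃ ι) : ConvergesAbsolutelyTo (fun k => f (e k)) s :=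
  (convergesAbsolutelyTo_iff_of_injective e.injective fun i hi =>
    (hi (e.surjective i)).elim).2 hf

/-- The norm of a fibre sum is at most the sum of the norms. The recursions give families indexed by
a mode and an exponent; this sums out the mode and leaves a series over exponents. -/
theorem ConvergesAbsolutelyTo.fiberwise {H : ι × E → ℂ} {s : ℂ} {G : E → ℂ}
    (hH : ConvergesAbsolutelyTo H s) (hG : ∀ e, HasSum (fun i => H (i, e)) (G e)) :
    ConvergesAbsolutelyTo G s := by
  have hH' := hH.comp_equiv (Equiv.prodComm E ι)
  refine ⟨hH'.1.prod.of_nonneg_of_le (fun _ => norm_nonneg _) fun e => ?_,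
    hH'.2.prod_fiberwise hG⟩
  rw [← (hG e).tsum_eq]
  exact norm_tsum_le_tsum_norm (hH'.1.prod_factor e)

/-- The product family is reindexed by the shear (i, e) ↦ (i, e + d i). The shift compensates for
the powers of the variables carried by the coefficient k i. -/
theorem ConvergesAbsolutelyTo.mul_shift [AddGroup E] {k : ι → ℂ} {f : E → ℂ} {s t : ℂ}
    (hk : ConvergesAbsolutelyTo k s) (hf : ConvergesAbsolutelyTo f t) (d : ι → E) :
    ConvergesAbsolutelyTo (fun p : ι × E => k p.1 * f (p.2 + d p.1)) (s * t) := by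
  have h1 : ConvergesAbsolutelyTo (fun p : ι × E => k p.1 * f p.2) (s * t) := by
    refine ⟨?_, hk.2.mul hf.2 (summable_mul_of_summable_norm hk.1 hf.1)⟩
    have := summable_mul_of_summable_norm (f := fun i => ‖k i‖) (g := fun i => ‖f i‖)
      (by simpa using hk.1) (by simpa using hf.1)
    simpa only [norm_mul] using this
  exact h1.comp_equiv (Equiv.prodShear (Equiv.refl ι) fun i => Equiv.addRight (d i))

theorem ConvergesAbsolutelyTo.shift [AddGroup E] {f : E → ℂ} {t : ℂ}
    (hf : ConvergesAbsolutelyTo f t) (d : E) : ConvergesAbsolutelyTo (fun e => f (e + d)) t :=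
  hf.comp_equiv (Equiv.addRight d)

theorem convergesAbsolutelyTo_of_finite {H : ι × E → ℂ} {s : ι → ℂ} (S : Finset ι)
    (h0 : ∀ i ∉ S, ∀ e, H (i, e) = 0)
    (hH : ∀ i ∈ S, ConvergesAbsolutelyTo (fun e => H (i, e)) (s i)) :
    ConvergesAbsolutelyTo H (∑ i ∈ S, s i) := by
  classical
  have h1 : ∀ i ∈ S, ConvergesAbsolutelyTo (fun p : ι × E => if p.1 = i then H p else 0) (s i) := by
    intro i hi
    refine (convergesAbsolutelyTo_iff_of_injective (Prod.mk_right_injective i) ?_).1 ?_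
    · rintro ⟨j, e⟩ hp
      rw [if_neg]
      rintro rfl
      exact hp ⟨e, rfl⟩
    · simpa using hH i hi
  refine (ConvergesAbsolutelyTo.sum S h1).of_eq (fun p => ?_) rfl
  rw [Finset.sum_ite_eq]
  split_ifs with hp
  · rfl
  · exact h0 p.1 hp p.2

end AbsoluteConvergence

/-! ### Binomial, Taylor and contraction series -/

section Series

theorem convergesAbsolutelyTo_binomial (y : ℤ) {t : ℂ} (ht : ‖t‖ < 1) :
    ConvergesAbsolutelyTo (fun j : ℕ => ((Ring.choose y j : ℤ) : ℂ) * t ^ j) ((1 + t) ^ y) := by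
  have H := Complex.one_add_cpow_hasFPowerSeriesOnBall_zero (a := (y : ℂ))
  have hmem : t ∈ Metric.eball (0 : ℂ) 1 := by
    rw [Metric.mem_eball, edist_zero_right]
    simpa [enorm_eq_nnnorm, ← NNReal.coe_lt_one] using ht
  have hterm : ∀ j : ℕ, (binomialSeries ℂ (y : ℂ) j fun _ => t) =
      ((Ring.choose y j : ℤ) : ℂ) * t ^ j := by
    intro j
    rw [binomialSeries_apply, ← eq_intCast (Int.castRingHom ℂ) y,
      ← Ring.map_choose (Int.castRingHom ℂ)]
    simp
  constructor
  · have := (binomialSeries ℂ (y : ℂ)).summable_norm_apply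
      (Metric.eball_subset_eball H.r_le hmem)
    simpa only [hterm] using this
  · have := H.hasSum hmem
    simpa only [hterm, zero_add, Complex.cpow_intCast] using this

/-- The shift `j ↦ m + j` from natural numbers to positive natural numbers. -/
def pnatAdd (m : ℕ+) (j : ℕ) : ℕ+ := ⟨m + j, Nat.add_pos_left m.pos j⟩

theorem pnatAdd_coe (m : ℕ+) (j : ℕ) : (pnatAdd m j : ℕ) = m + j := rfl

theorem pnatAdd_injective (m : ℕ+) : Function.Injective (pnatAdd m) := fun i j hij => by
  have := congrArg PNat.val hij
  simp only [pnatAdd] at this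
  exact Nat.add_left_cancel this

theorem lt_of_notMem_range_pnatAdd {m p : ℕ+} (hp : p ∉ Set.range (pnatAdd m)) :
    (p : ℕ) < m := by
  by_contra H
  exact hp ⟨p - m, PNat.eq (by rw [pnatAdd_coe]; omega)⟩

/-- Taylor's formula for the divided derivatives of `z ^ (-l - 1)`. -/
theorem convergesAbsolutelyTo_taylor (m : ℕ+) (l : ℤ) {x z : ℂ} (hxz : ‖x‖ < ‖z‖) :
    ConvergesAbsolutelyTo (fun p : ℕ+ => derivCoeff m (-(p : ℕ)) * derivCoeff p l *
      x ^ ((p : ℕ) - (m : ℕ) : ℤ) * z ^ (-l - (p : ℕ))) (derivCoeff m l * (z + x) ^ (-l - (m : ℕ))) := by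
  have hz : z ≠ 0 := norm_pos_iff.1 ((norm_nonneg x).trans_lt hxz)
  have ht : ‖x / z‖ < 1 := by
    rw [norm_div]; exact (div_lt_one (norm_pos_iff.2 hz)).2 hxz
  refine (convergesAbsolutelyTo_iff_of_injective (pnatAdd_injective m) fun p hp => ?_).1 ?_
  · have h1 := lt_of_notMem_range_pnatAdd hp
    rw [derivCoeff_eq_zero (by have := p.pos; omega) (by omega)]
    simp
  · refine ((convergesAbsolutelyTo_binomial (-l - (m : ℕ)) ht).const_mul
      (derivCoeff m l * z ^ (-l - (m : ℕ)))).of_eq (fun j => ?_) ?_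
    · have hm := PNat.natPred_add_one m
      have hp : (pnatAdd m j).natPred = m.natPred + j := by
        have := PNat.natPred_add_one (pnatAdd m j)
        rw [pnatAdd_coe] at this
        omega
      -- With r = -l-1 and k = m-1, the identity (r choose k+j)(k+j choose k) = (r choose k)(r-k
      -- choose j) leaves the binomial series of exponent -l-m in x/z.
      have h2 := Ring.choose_smul_choose (-l - 1) (n := m.natPred + j) (k := m.natPred) (by omega)
      rw [Nat.add_sub_cancel_left, natPred_cast, nsmul_eq_mul,
        show -l - 1 - (((m : ℕ) : ℤ) - 1) = -l - (m : ℕ) by ring] at h2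
      have h3 := congrArg (Int.cast : ℤ → ℂ) h2
      push_cast at h3
      rw [derivCoeff_neg, derivCoeff, hp, h3, pnatAdd_coe, derivCoeff,
        show (((m + j : ℕ) : ℤ) - (m : ℕ)) = j by push_cast; ring,
        show -l - ((m + j : ℕ) : ℤ) = (-l - (m : ℕ)) - j by push_cast; ring, zpow_sub₀ hz,
        zpow_natCast, zpow_natCast, div_pow]
      ring
    · rw [mul_assoc, ← mul_zpow, mul_add, mul_one, mul_div_cancel₀ _ hz]

theorem derivCoeff_pnat (m p : ℕ+) :
    derivCoeff m (p : ℕ) = (-1) ^ m.natPred * (Nat.choose (p + m.natPred) m.natPred : ℂ) := by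
  have h1 : -((p : ℕ) : ℤ) - 1 = -(((p : ℕ) + 1 : ℕ) : ℤ) := by push_cast; ring
  have h2 : ((((p : ℕ) + 1 : ℕ) : ℤ) + m.natPred - 1) = (((p : ℕ) + m.natPred : ℕ) : ℤ) := by
    push_cast; ring
  rw [derivCoeff, h1, Ring.choose_neg, h2, Ring.choose_natCast, Int.negOnePow_def]
  simp [Units.smul_def]

/-- With k = m-1, both sides are, up to sign, the multinomial coefficient (q+j+k)!/(q! j! k!). The
factor (-1)^j cancels the sign of the binomial coefficient with negative upper entry. -/
theorem derivCoeff_mul_choose (m q : ℕ+) (j : ℕ) :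
    derivCoeff m (pnatAdd q j : ℕ) * (Nat.choose (pnatAdd q j) q : ℂ) =
      derivCoeff m (q : ℕ) * ((Ring.choose (-(m : ℕ) - (q : ℕ) : ℤ) j : ℤ) : ℂ) * (-1) ^ j := by
  have hm := PNat.natPred_add_one m
  have h1 : (-(m : ℕ) - (q : ℕ) : ℤ) = -(((m : ℕ) + (q : ℕ) : ℕ) : ℤ) := by push_cast; ring
  have h2 : ((((m : ℕ) + (q : ℕ) : ℕ) : ℤ) + j - 1) = ((q + m.natPred + j : ℕ) : ℤ) := by
    push_cast; rw [natPred_cast]; ring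
  rw [h1, Ring.choose_neg, h2, Ring.choose_natCast, derivCoeff_pnat, derivCoeff_pnat, pnatAdd_coe]
  set k := m.natPred
  have e1 := Nat.choose_mul (n := q + j + k) (k := q + j) (s := q) (by omega)
  have e2 := Nat.choose_mul (n := q + j + k) (k := q + k) (s := q) (by omega)
  have e3 : (q + j + k - q).choose (q + j - q) = (q + j + k - q).choose (q + k - q) :=
    Nat.choose_symm_of_eq_add (by omega)
  have e4 : ((q : ℕ) + j + k).choose (q + j) = (q + j + k).choose k :=
    Nat.choose_symm_of_eq_add (by omega)
  have e5 : ((q : ℕ) + j + k).choose (q + k) = (q + k + j).choose j := by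
    rw [show (q : ℕ) + j + k = q + k + j by ring]
    exact Nat.choose_symm_of_eq_add (by omega)
  have e6 : ((q : ℕ) + k).choose q = (q + k).choose k := Nat.choose_symm_of_eq_add (by omega)
  rw [e3] at e1
  have e := e1.trans e2.symm
  rw [e4, e5, e6] at e
  have e' := congrArg (Nat.cast : ℕ → ℂ) e
  push_cast at e'
  rw [mul_assoc, e', Int.negOnePow_def]
  have hs : ((-1 : ℂ) ^ j) * (-1) ^ j = 1 := by rw [← mul_pow]; simp
  simp only [zpow_natCast, Units.smul_def, Units.val_pow_eq_pow_val, Units.val_neg, Units.val_one,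
    smul_eq_mul, Int.cast_mul, Int.cast_pow, Int.cast_neg, Int.cast_one, Int.cast_natCast]
  linear_combination (-(-1) ^ k * ((q + k).choose k : ℂ) * ((q + k + j).choose j : ℂ)) * hs

/-- The expansion of the two-point contraction in the region `‖w‖ < ‖z‖`. -/
theorem convergesAbsolutelyTo_contraction (m q : ℕ+) {z w : ℂ} (hwz : ‖w‖ < ‖z‖) :
    ConvergesAbsolutelyTo (fun p : ℕ+ => derivCoeff m (p : ℕ) * (Nat.choose p q : ℂ) *
      z ^ (-(p : ℕ) - (m : ℕ) : ℤ) * w ^ ((p : ℕ) - (q : ℕ) : ℤ))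
      (derivCoeff m (q : ℕ) * (z - w) ^ (-(m : ℕ) - (q : ℕ) : ℤ)) := by
  have hz : z ≠ 0 := norm_pos_iff.1 ((norm_nonneg w).trans_lt hwz)
  have ht : ‖-(w / z)‖ < 1 := by
    rw [norm_neg, norm_div]; exact (div_lt_one (norm_pos_iff.2 hz)).2 hwz
  refine (convergesAbsolutelyTo_iff_of_injective (pnatAdd_injective q) fun p hp => ?_).1 ?_
  · rw [Nat.choose_eq_zero_of_lt (lt_of_notMem_range_pnatAdd hp)]
    simp
  · refine ((convergesAbsolutelyTo_binomial (-(m : ℕ) - (q : ℕ)) ht).const_mul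
      (derivCoeff m (q : ℕ) * z ^ (-(m : ℕ) - (q : ℕ) : ℤ))).of_eq (fun j => ?_) ?_
    · rw [derivCoeff_mul_choose, pnatAdd_coe,
        show -((q + j : ℕ) : ℤ) - (m : ℕ) = -(m : ℕ) - (q : ℕ) - j by push_cast; ring,
        show (((q + j : ℕ) : ℤ) - (q : ℕ)) = j by push_cast; ring, zpow_sub₀ hz,
        zpow_natCast, zpow_natCast, neg_pow (w / z), div_pow]
      ring
    · rw [mul_assoc, ← mul_zpow, ← sub_eq_add_neg, mul_sub, mul_one, mul_div_cancel₀ _ hz]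

end Series

/-! ### Rational functions with prescribed poles -/

section Rational

variable {n : ℕ}

/-- The denominator `∏ᵢ zᵢ ∏_{i < j} (zᵢ - zⱼ)`. -/
noncomputable def poleDenom (z : Fin n → ℂ) : ℂ :=
  (∏ i, z i) * ∏ i, ∏ j ∈ Finset.Ioi i, (z i - z j)

/-- The function `F` agrees, away from the hyperplanes `zᵢ = 0` and `zᵢ = zⱼ`, with a rational
function which has poles at most there. -/
def IsRational (F : (Fin n → ℂ) → ℂ) : Prop :=
  ∃ (p : MvPolynomial (Fin n) ℂ) (N : ℕ), ∀ z, poleDenom z ≠ 0 →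
    F z = MvPolynomial.eval z p / poleDenom z ^ N

theorem poleDenom_ne_zero_iff {z : Fin n → ℂ} :
    poleDenom z ≠ 0 ↔ (∀ i, z i ≠ 0) ∧ ∀ i j, i < j → z i - z j ≠ 0 := by
  simp [poleDenom, Finset.prod_ne_zero_iff]

theorem poleDenom_ne_zero {z : Fin n → ℂ} (hz : StrictAnti fun i => ‖z i‖) (h0 : ∀ i, z i ≠ 0) :
    poleDenom z ≠ 0 := by
  refine poleDenom_ne_zero_iff.2 ⟨h0, fun i j hij h => ?_⟩
  have : ‖z j‖ < ‖z i‖ := hz hij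
  rw [sub_eq_zero.1 h] at this
  exact lt_irrefl _ this

variable (n) in
/-- The polynomial `∏ᵢ zᵢ ∏_{i < j} (zᵢ - zⱼ)`. -/
noncomputable def polePoly : MvPolynomial (Fin n) ℂ :=
  (∏ i, MvPolynomial.X i) * ∏ i, ∏ j ∈ Finset.Ioi i, (MvPolynomial.X i - MvPolynomial.X j)

theorem eval_polePoly (z : Fin n → ℂ) : MvPolynomial.eval z (polePoly n) = poleDenom z := by
  simp [polePoly, poleDenom, map_prod]

theorem isRational_eval (p : MvPolynomial (Fin n) ℂ) :
    IsRational fun z => MvPolynomial.eval z p := ⟨p, 0, by simp⟩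

theorem isRational_const (c : ℂ) : IsRational fun _ : Fin n → ℂ => c := by
  simpa using isRational_eval (n := n) (MvPolynomial.C c)

theorem IsRational.add {F G : (Fin n → ℂ) → ℂ} (hF : IsRational F) (hG : IsRational G) :
    IsRational fun z => F z + G z := by
  obtain ⟨p, N, hp⟩ := hF
  obtain ⟨q, M, hq⟩ := hG
  refine ⟨p * polePoly n ^ M + q * polePoly n ^ N, N + M, fun z hz => ?_⟩
  simp only [hp z hz, hq z hz, map_add, map_mul, map_pow, eval_polePoly]
  field_simp
  ring

theorem IsRational.mul {F G : (Fin n → ℂ) → ℂ} (hF : IsRational F) (hG : IsRational G) :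
    IsRational fun z => F z * G z := by
  obtain ⟨p, N, hp⟩ := hF
  obtain ⟨q, M, hq⟩ := hG
  refine ⟨p * q, N + M, fun z hz => ?_⟩
  simp only [hp z hz, hq z hz, map_mul, pow_add, div_mul_div_comm]

theorem IsRational.const_mul {F : (Fin n → ℂ) → ℂ} (hF : IsRational F) (c : ℂ) :
    IsRational fun z => c * F z := (isRational_const c).mul hF

theorem IsRational.sum {κ : Type*} {F : κ → (Fin n → ℂ) → ℂ} (S : Finset κ)
    (hF : ∀ k ∈ S, IsRational (F k)) : IsRational fun z => ∑ k ∈ S, F k z := by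
  classical
  induction S using Finset.induction_on with
  | empty => simpa using isRational_const 0
  | insert j S hj ih =>
    simp only [Finset.sum_insert hj]
    exact (hF j (by simp)).add (ih fun i hi => hF i (by simp [hi]))

theorem IsRational.prod {κ : Type*} {F : κ → (Fin n → ℂ) → ℂ} (S : Finset κ)
    (hF : ∀ k ∈ S, IsRational (F k)) : IsRational fun z => ∏ k ∈ S, F k z := by
  classical
  induction S using Finset.induction_on with
  | empty => simpa using isRational_const 1
  | insert j S hj ih =>
    simp only [Finset.prod_insert hj]
    exact (hF j (by simp)).mul (ih fun i hi => hF i (by simp [hi]))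

theorem IsRational.pow {F : (Fin n → ℂ) → ℂ} (hF : IsRational F) (k : ℕ) :
    IsRational fun z => F z ^ k := by
  simpa using IsRational.prod (Finset.range k) fun _ _ => hF

/-- If fg is the pole polynomial then 1/f = g/(fg), so negative powers of its divisors are
admissible. -/
theorem isRational_zpow_of_dvd {f : MvPolynomial (Fin n) ℂ} (hf : f ∣ polePoly n) (k : ℤ) :
    IsRational fun z => MvPolynomial.eval z f ^ k := by
  obtain ⟨g, hg⟩ := hf
  have hinv : IsRational fun z => (MvPolynomial.eval z f)⁻¹ := by
    refine ⟨g, 1, fun z hz => ?_⟩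
    rw [pow_one]
    rw [← eval_polePoly, hg, map_mul] at hz ⊢
    rw [mul_comm, ← div_div, div_self (right_ne_zero_of_mul hz), one_div]
  obtain ⟨k, rfl | rfl⟩ := k.eq_nat_or_neg
  · simpa using (isRational_eval f).pow k
  · simpa using hinv.pow k

theorem isRational_zpow (i : Fin n) (k : ℤ) : IsRational fun z => z i ^ k := by
  simpa using isRational_zpow_of_dvd (n := n) (f := MvPolynomial.X i)
    ((Finset.dvd_prod_of_mem _ (Finset.mem_univ i)).mul_right _) k

theorem isRational_sub_zpow {i j : Fin n} (hij : i < j) (k : ℤ) :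
    IsRational fun z => (z i - z j) ^ k := by
  simpa using isRational_zpow_of_dvd (n := n) (f := MvPolynomial.X i - MvPolynomial.X j)
    (((Finset.dvd_prod_of_mem (fun j => (MvPolynomial.X i - MvPolynomial.X j :
      MvPolynomial (Fin n) ℂ)) (Finset.mem_Ioi.2 hij)).trans
      (Finset.dvd_prod_of_mem (fun i => ∏ j ∈ Finset.Ioi i,
        (MvPolynomial.X i - MvPolynomial.X j : MvPolynomial (Fin n) ℂ))
        (Finset.mem_univ i))).mul_left _) k

theorem IsRational.comp_tail {F : (Fin n → ℂ) → ℂ} (hF : IsRational F) :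
    IsRational fun z : Fin (n + 1) → ℂ => F (Fin.tail z) := by
  obtain ⟨p, N, hp⟩ := hF
  -- The denominator in the last n variables is rewritten as inverse powers of factors of the larger
  -- denominator, each already known to be admissible.
  have h1 : IsRational fun z : Fin (n + 1) → ℂ =>
      MvPolynomial.eval z (MvPolynomial.rename Fin.succ p) *
      ((∏ i : Fin n, z i.succ ^ (-1 : ℤ)) *
        ∏ i : Fin n, ∏ j ∈ Finset.Ioi i, (z i.succ - z j.succ) ^ (-1 : ℤ)) ^ N :=
    (isRational_eval _).mul (((IsRational.prod _ fun i _ => isRational_zpow i.succ _).mul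
      (IsRational.prod _ fun i _ => IsRational.prod _ fun j hj =>
        isRational_sub_zpow (Fin.succ_lt_succ_iff.2 (Finset.mem_Ioi.1 hj)) _)).pow N)
  obtain ⟨q, M, hq⟩ := h1
  refine ⟨q, M, fun z hz => ?_⟩
  rw [← hq z hz]
  have hz' : poleDenom (Fin.tail z) ≠ 0 := by
    rw [poleDenom_ne_zero_iff] at hz ⊢
    exact ⟨fun i => hz.1 i.succ, fun i j hij => hz.2 _ _ (Fin.succ_lt_succ_iff.2 hij)⟩
  simp only [hp _ hz', MvPolynomial.eval_rename, div_eq_mul_inv, zpow_neg_one, Finset.prod_inv_distrib, ← mul_inv, inv_pow]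
  rfl

end Rational

/-! ### Functionals vanishing in high weight -/

section Functionals

/-- The functional `φ` vanishes on all homogeneous subspaces of sufficiently large weight. -/
def VanishesAbove (φ : Dual ℂ (TMinus h)) : Prop :=
  ∃ K : ℤ, ∀ n, K < n → ∀ v ∈ weightSpace h n, φ v = 0

/-- The recursions replace φ by v ↦ φ(a(-p)v); vanishing in high weight is all they need, and it
passes to these functionals. -/
theorem IsGradedDual.vanishesAbove {φ : Dual ℂ (TMinus h)}
    (hφ : IsGradedDual (weightSpace h) φ) : VanishesAbove φ := by
  obtain ⟨K, hK⟩ := hφ.bddAbove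
  refine ⟨K, fun n hn v hv => ?_⟩
  by_contra H
  exact not_lt.2 (hK ⟨v, hv, H⟩) hn

/-- The functional `v ↦ φ(a(-p)v)`. -/
noncomputable def compLetter (φ : Dual ℂ (TMinus h)) (p : ℕ+) (a : h) : Dual ℂ (TMinus h) :=
  φ ∘ₗ LinearMap.mulLeft ℂ (letter p a)

theorem compLetter_apply (φ : Dual ℂ (TMinus h)) (p : ℕ+) (a : h) (v : TMinus h) :
    compLetter φ p a v = φ (letter p a * v) := rfl

theorem VanishesAbove.compLetter {φ : Dual ℂ (TMinus h)} (hφ : VanishesAbove φ) (p : ℕ+) (a : h) :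
    VanishesAbove (compLetter φ p a) := by
  obtain ⟨K, hK⟩ := hφ
  exact ⟨K, fun n hn v hv => hK _ (by have := p.pos; omega) _ (letter_mul_mem_weightSpace p a hv)⟩

/-- Weights are nonnegative, so a(-p)v has components only in weights at least p. -/
theorem VanishesAbove.exists_compLetter_eq_zero {φ : Dual ℂ (TMinus h)} (hφ : VanishesAbove φ) :
    ∃ M : ℕ, ∀ (a : h) (p : ℕ+), M < p → Mosva.compLetter φ p a = 0 := by
  obtain ⟨K, hK⟩ := hφ
  refine ⟨K.toNat, fun a p hp => LinearMap.ext fun v => ?_⟩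
  induction v using TMinus.induction_homogeneous with
  | mem n u hu =>
    rcases lt_or_ge n 0 with hn | hn
    · rw [weightSpace_neg hn, Submodule.mem_bot] at hu
      simp [hu]
    · exact hK _ (by omega) _ (letter_mul_mem_weightSpace p a hu)
  | add u v hu hv => rw [map_add, hu, hv, map_add]

theorem exists_finset_pnat {P : ℕ+ → Prop} {M : ℕ} (hP : ∀ p : ℕ+, M < p → P p) :
    ∃ S : Finset ℕ+, ∀ p ∉ S, P p := by
  refine ⟨Finset.Icc 1 ⟨M + 1, M.succ_pos⟩, fun p hp => hP p ?_⟩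
  by_contra H
  exact hp (Finset.mem_Icc.2 ⟨one_le, PNat.coe_le_coe _ _ |>.1 (by simp; omega)⟩)

/-- One finite set of modes serves φ, v and all uⱼ, which makes the recursion a finite sum. -/
theorem VanishesAbove.exists_finset (B : LinearMap.BilinForm ℂ h) {φ : Dual ℂ (TMinus h)}
    (hφ : VanishesAbove φ) (v : TMinus h) {k : ℕ} (u : Fin k → TMinus h) (a : h) :
    ∃ S : Finset ℕ+, ∀ p ∉ S, Mosva.compLetter φ p a = 0 ∧ mode B (p : ℕ) a v = 0 ∧
      ∀ j, mode B (p : ℕ) a (u j) = 0 := by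
  obtain ⟨M₁, h₁⟩ := hφ.exists_compLetter_eq_zero
  obtain ⟨M₂, h₂⟩ := exists_mode_eq_zero B v
  choose M₃ h₃ using fun j => exists_mode_eq_zero B (u j)
  refine exists_finset_pnat (M := max (max M₁ M₂) (Finset.univ.sup M₃)) fun p hp => ?_
  rw [max_lt_iff, max_lt_iff] at hp
  refine ⟨h₁ a p hp.1.1, h₂ a _ (by exact_mod_cast hp.1.2), fun j => h₃ j a _ ?_⟩
  exact_mod_cast (Finset.le_sup (Finset.mem_univ j)).trans_lt hp.2

end Functionals

/-! ### Products of vertex operators -/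

section Product

variable (B : LinearMap.BilinForm ℂ h)

theorem _root_.HasSum.of_eq {ι : Type*} {f g : ι → ℂ} {s : ℂ} (hf : HasSum f s)
    (h : ∀ i, g i = f i) : HasSum g s := by
  rwa [funext h]

/-- The recursion for `vertexOperatorMap`, evaluated on a functional and separated into
creation and annihilation parts. -/
theorem exists_hasSum_vertexOperatorMap_letter_mul (ψ : Dual ℂ (TMinus h)) (m : ℕ+) (a : h)
    (u : TMinus h) (N : ℤ) (v : TMinus h) : ∃ s t : ℂ,
    HasSum (fun p : ℕ+ => derivCoeff m (-(p : ℕ)) *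
      ψ (letter p a * vertexOperatorMap B u (N - (p : ℕ) + (m : ℕ)) v)) s ∧
    HasSum (fun p : ℕ+ => derivCoeff m (p : ℕ) *
      ψ (vertexOperatorMap B u (N + (p : ℕ) + (m : ℕ)) (mode B (p : ℕ) a v))) t ∧
    ψ (vertexOperatorMap B (letter m a * u) N v) = s + t := by
  have H := (vertexOperatorMap_letter_mul B m a u N v).map_linear ψ
  set f : ℤ → ℂ := fun n => ψ (derivCoeff m n • modeTerm B u a (N + n + (m : ℕ)) v n) with hf
  have H1 : HasFinsum (fun n => if n < 0 then f n else 0)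
      (∑ᶠ n, if n < 0 then f n else 0) :=
    ⟨H.1.subset fun n hn => by
      rw [Function.mem_support] at hn ⊢
      exact fun h0 => hn (by rw [h0, ite_self]), rfl⟩
  have H2 := H.sub H1
  refine ⟨∑ᶠ n, if n < 0 then f n else 0, _, ?_, ?_, (add_sub_cancel _ _).symm⟩
  · have hinj : Function.Injective fun p : ℕ+ => -((p : ℕ) : ℤ) := fun p q hpq =>
      PNat.eq (by simpa using hpq)
    refine ((hinj.hasSum_iff ?_).2 H1.hasSum).of_eq ?_
    · intro n hn
      rw [if_neg]
      intro h0
      obtain ⟨p, rfl⟩ := pnat_of_neg h0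
      exact hn ⟨p, rfl⟩
    · intro p
      have hp : -((p : ℕ) : ℤ) < 0 := by have := p.pos; omega
      simp only [Function.comp_apply, if_pos hp, hf, modeTerm, mode_neg, map_smul, smul_eq_mul,
        sub_eq_add_neg]
  · have hinj : Function.Injective fun p : ℕ+ => ((p : ℕ) : ℤ) := fun p q hpq =>
      PNat.eq (by simpa using hpq)
    refine ((hinj.hasSum_iff ?_).2 H2.hasSum).of_eq ?_
    · intro n hn
      rcases lt_trichotomy n 0 with h0 | rfl | h0
      · rw [if_pos h0, sub_self]
      -- The mode n = 0 appears in neither sum because a(0) = 0.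
      · simp [hf, modeTerm]
      · obtain ⟨p, rfl⟩ := pnat_of_pos h0
        exact (hn ⟨p, rfl⟩).elim
    · intro p
      have hp : ¬((p : ℕ) : ℤ) < 0 := by omega
      simp only [Function.comp_apply, if_neg hp, hf, modeTerm, map_smul, smul_eq_mul, sub_zero]

/-- The coefficient of `z₁^e₁ ⋯ zₖ^eₖ` in `Y(u₁, z₁) ⋯ Y(uₖ, zₖ)v`. -/
noncomputable def productVec {k : ℕ} (u : Fin k → TMinus h) (v : TMinus h) (e : Fin k → ℤ) :
    TMinus h :=
  (List.ofFn fun i => vertexOperatorMap B (u i) (e i)).prod v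

theorem productTerm_eq {k : ℕ} (u : Fin k → TMinus h) (v : TMinus h) (φ : Dual ℂ (TMinus h))
    (z : Fin k → ℂ) (e : Fin k → ℤ) :
    productTerm (vertexOperatorMap B) u v φ z e = φ (productVec B u v e) * ∏ i, z i ^ e i := rfl

theorem productVec_succ {k : ℕ} (u : Fin (k + 1) → TMinus h) (v : TMinus h)
    (e : Fin (k + 1) → ℤ) :
    productVec B u v e =
      vertexOperatorMap B (u 0) (e 0) (productVec B (Fin.tail u) v (Fin.tail e)) := by
  simp [productVec, List.ofFn_succ, Fin.tail]

theorem tail_single_zero {k : ℕ} (c : ℤ) :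
    Fin.tail (Pi.single (0 : Fin (k + 1)) c : Fin (k + 1) → ℤ) = 0 := by
  ext i; simp [Fin.tail]

theorem tail_single_succ {k : ℕ} (j : Fin k) (c : ℤ) :
    Fin.tail (Pi.single j.succ c : Fin (k + 1) → ℤ) = Pi.single j c := by
  ext i; simp [Fin.tail, Pi.single_apply]

theorem tail_add {k : ℕ} (e d : Fin (k + 1) → ℤ) :
    Fin.tail (e + d) = Fin.tail e + Fin.tail d := rfl

theorem mode_productVec_aux {k : ℕ} (n : ℕ+) (a : h) (u : Fin k → TMinus h) (v : TMinus h)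
    (S : Finset ℕ+) (hS : ∀ p ≤ n, p ∈ S) (e : Fin k → ℤ) :
    mode B (n : ℕ) a (productVec B u v e) = productVec B u (mode B (n : ℕ) a v) e +
      ∑ j, ∑ p ∈ S, (Nat.choose n p : ℂ) • productVec B (Function.update u j (mode B (p : ℕ) a (u j)))
        v (e + Pi.single j ((p : ℕ) - (n : ℕ) : ℤ)) := by
  induction k with
  | zero => simp [productVec]
  | succ k ih =>
    have h0 : ∀ j : Fin k, (0 : Fin (k + 1)) ≠ j.succ := fun j => (Fin.succ_ne_zero j).symm
    simp only [Fin.sum_univ_succ, productVec_succ, mode_vertexOperatorMap B n a _ S hS, ih,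
      map_add, map_sum, map_smul, Fin.tail_update_zero, Fin.tail_update_succ,
      Function.update_self, Function.update_of_ne (h0 _), tail_add, tail_single_zero,
      tail_single_succ, Pi.add_apply, Pi.single_eq_same, Pi.single_eq_of_ne (h0 _), add_zero]
    rw [add_assoc]
    congr 1
    rw [add_comm]
    congr 1
    refine Finset.sum_congr rfl fun p _ => ?_
    rw [show e 0 - (n : ℕ) + ((p : ℕ) : ℤ) = e 0 + ((p : ℕ) - (n : ℕ)) by ring]

theorem productVec_update_zero {k : ℕ} (u : Fin k → TMinus h) (v : TMinus h) (e : Fin k → ℤ)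
    (j : Fin k) : productVec B (Function.update u j 0) v e = 0 := by
  induction k with
  | zero => exact j.elim0
  | succ k ih =>
    rw [productVec_succ]
    cases j using Fin.cases with
    | zero => simp
    | succ j => rw [Fin.tail_update_succ, ih, map_zero]

/-- Here S depends on the vectors uⱼ but not on n. This lets the sum over n be carried out for each
fixed p in S, producing a power of z₀ - zⱼ. -/
theorem mode_productVec {k : ℕ} (n : ℕ+) (a : h) (u : Fin k → TMinus h) (v : TMinus h)
    (S : Finset ℕ+) (hS : ∀ p ∉ S, ∀ j, mode B (p : ℕ) a (u j) = 0) (e : Fin k → ℤ) :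
    mode B (n : ℕ) a (productVec B u v e) = productVec B u (mode B (n : ℕ) a v) e +
      ∑ j, ∑ p ∈ S, (Nat.choose n p : ℂ) • productVec B (Function.update u j (mode B (p : ℕ) a (u j)))
        v (e + Pi.single j ((p : ℕ) - (n : ℕ) : ℤ)) := by
  classical
  rw [mode_productVec_aux B n a u v (S ∪ Finset.Icc 1 n) fun p hp =>
    Finset.mem_union_right _ (Finset.mem_Icc.2 ⟨one_le, hp⟩)]
  congr 1
  refine Finset.sum_congr rfl fun j _ => (Finset.sum_subset Finset.subset_union_left ?_).symm
  intro p _ hp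
  rw [hS p hp j, productVec_update_zero, smul_zero]

theorem prod_zpow_add {k : ℕ} {z : Fin k → ℂ} (hz : ∀ i, z i ≠ 0) (e d : Fin k → ℤ) :
    ∏ i, z i ^ (e + d) i = (∏ i, z i ^ e i) * ∏ i, z i ^ d i := by
  rw [← Finset.prod_mul_distrib]
  exact Finset.prod_congr rfl fun i _ => zpow_add₀ (hz i) _ _

theorem prod_zpow_single {k : ℕ} (z : Fin k → ℂ) (j : Fin k) (c : ℤ) :
    ∏ i, z i ^ (Pi.single j c : Fin k → ℤ) i = z j ^ c := by
  rw [Finset.prod_eq_single j]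
  · simp
  · intro i _ hi; simp [Pi.single_eq_of_ne hi]
  · simp

theorem ConvergesAbsolutelyTo.finite_shift {ι E : Type*} [AddGroup E] (k : ι → ℂ) {f : ι → E → ℂ}
    {s : ι → ℂ} (hf : ∀ i, ConvergesAbsolutelyTo (f i) (s i)) (d : ι → E) (S : Finset ι)
    (h0 : ∀ i ∉ S, ∀ e, f i e = 0) :
    ConvergesAbsolutelyTo (fun p : ι × E => k p.1 * f p.1 (p.2 + d p.1)) (∑ i ∈ S, k i * s i) := by
  refine convergesAbsolutelyTo_of_finite (H := fun p : ι × E => k p.1 * f p.1 (p.2 + d p.1))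
    (s := fun i => k i * s i) S (fun i hi e => ?_) fun i _ => ?_
  · simp only [h0 i hi, mul_zero]
  · exact ((hf i).shift (d i)).const_mul (k i)

theorem productTerm_cons_shift {k : ℕ} (u : TMinus h) (u' : Fin k → TMinus h) (v : TMinus h)
    (φ : Dual ℂ (TMinus h)) {z : Fin (k + 1) → ℂ} (h0 : ∀ i, z i ≠ 0) (e : Fin (k + 1) → ℤ)
    (c : ℤ) :
    productTerm (vertexOperatorMap B) (Fin.cons u u' : Fin (k + 1) → TMinus h) v φ z
      (e + Pi.single 0 c) =
    φ (vertexOperatorMap B u (e 0 + c) (productVec B u' v (Fin.tail e))) *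
      (∏ i, z i ^ e i) * z 0 ^ c := by
  rw [productTerm_eq, productVec_succ, Fin.cons_zero, Fin.tail_cons, tail_add,
    tail_single_zero, add_zero, prod_zpow_add h0, prod_zpow_single, Pi.add_apply,
    Pi.single_eq_same, mul_assoc]

theorem productTerm_cons_shift_shift {k : ℕ} (u : TMinus h) (u' : Fin k → TMinus h)
    (v : TMinus h) (φ : Dual ℂ (TMinus h)) {z : Fin (k + 1) → ℂ} (h0 : ∀ i, z i ≠ 0)
    (e : Fin (k + 1) → ℤ) (c d : ℤ) (j : Fin k) :
    productTerm (vertexOperatorMap B) (Fin.cons u u' : Fin (k + 1) → TMinus h) v φ z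
      (e + (Pi.single 0 c + Pi.single j.succ d)) =
    φ (vertexOperatorMap B u (e 0 + c) (productVec B u' v (Fin.tail e + Pi.single j d))) *
      (∏ i, z i ^ e i) * (z 0 ^ c * z j.succ ^ d) := by
  rw [productTerm_eq, productVec_succ, Fin.cons_zero, Fin.tail_cons, tail_add, tail_add,
    tail_single_zero, zero_add, tail_single_succ, prod_zpow_add h0, prod_zpow_add h0,
    prod_zpow_single, prod_zpow_single, Pi.add_apply, Pi.add_apply, Pi.single_eq_same,
    Pi.single_eq_of_ne (Fin.succ_ne_zero j).symm, add_zero, mul_assoc]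

/-- Entry (p, e) of the shifted creation family is the p-th creation summand of the coefficient at
e: the shift by m - p in the exponent cancels z₀^(p-m). -/
theorem productTerm_creation {k : ℕ} (m p : ℕ+) (a : h) (u : TMinus h) (u' : Fin k → TMinus h)
    (v : TMinus h) (φ : Dual ℂ (TMinus h)) {z : Fin (k + 1) → ℂ} (h0 : ∀ i, z i ≠ 0)
    (e : Fin (k + 1) → ℤ) :
    derivCoeff m (-(p : ℕ)) * z 0 ^ ((p : ℕ) - (m : ℕ) : ℤ) *
      productTerm (vertexOperatorMap B) (Fin.cons u u' : Fin (k + 1) → TMinus h) v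
        (compLetter φ p a) z (e + Pi.single 0 ((m : ℕ) - (p : ℕ) : ℤ)) =
    derivCoeff m (-(p : ℕ)) * φ (letter p a * vertexOperatorMap B u (e 0 - (p : ℕ) + (m : ℕ))
      (productVec B u' v (Fin.tail e))) * ∏ i, z i ^ e i := by
  rw [productTerm_cons_shift B u u' v _ h0, compLetter_apply,
    show e 0 + (((m : ℕ) : ℤ) - (p : ℕ)) = e 0 - (p : ℕ) + (m : ℕ) by ring,
    show ((m : ℕ) : ℤ) - (p : ℕ) = -((p : ℕ) - (m : ℕ)) by ring, zpow_neg]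
  have := mul_inv_cancel₀ (zpow_ne_zero ((p : ℕ) - (m : ℕ) : ℤ) (h0 0))
  linear_combination (derivCoeff m (-(p : ℕ)) * φ (letter p a *
    vertexOperatorMap B u (e 0 - (p : ℕ) + (m : ℕ)) (productVec B u' v (Fin.tail e))) *
    ∏ i, z i ^ e i) * this

/-- The analogue for annihilation: a(p) is moved through all later fields, giving the term in a(p)v
and one contraction for each field j and each q in S. -/
theorem productTerm_annihilation {k : ℕ} (m p : ℕ+) (a : h) (u : TMinus h)
    (u' : Fin k → TMinus h) (v : TMinus h) (φ : Dual ℂ (TMinus h)) {z : Fin (k + 1) → ℂ}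
    (h0 : ∀ i, z i ≠ 0) (e : Fin (k + 1) → ℤ) (S : Finset ℕ+)
    (hS : ∀ p ∉ S, ∀ j, mode B (p : ℕ) a (u' j) = 0) :
    derivCoeff m (p : ℕ) * z 0 ^ (-(p : ℕ) - (m : ℕ) : ℤ) *
        productTerm (vertexOperatorMap B) (Fin.cons u u' : Fin (k + 1) → TMinus h)
          (mode B (p : ℕ) a v) φ z (e + Pi.single 0 ((p : ℕ) + (m : ℕ) : ℤ)) +
      ∑ j, ∑ q ∈ S, derivCoeff m (p : ℕ) * (Nat.choose p q : ℂ) *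
        z 0 ^ (-(p : ℕ) - (m : ℕ) : ℤ) * z j.succ ^ ((p : ℕ) - (q : ℕ) : ℤ) *
        productTerm (vertexOperatorMap B)
          (Fin.cons u (Function.update u' j (mode B (q : ℕ) a (u' j))) : Fin (k + 1) → TMinus h)
          v φ z (e + (Pi.single 0 ((p : ℕ) + (m : ℕ) : ℤ) +
            Pi.single j.succ ((q : ℕ) - (p : ℕ) : ℤ))) =
    derivCoeff m (p : ℕ) * φ (vertexOperatorMap B u (e 0 + (p : ℕ) + (m : ℕ))
      (mode B (p : ℕ) a (productVec B u' v (Fin.tail e)))) * ∏ i, z i ^ e i := by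
  rw [mode_productVec B p a u' v S hS (Fin.tail e), productTerm_cons_shift B u u' _ φ h0]
  simp only [productTerm_cons_shift_shift B u _ v φ h0, map_add, map_sum, map_smul, smul_eq_mul,
    mul_add, add_mul, Finset.mul_sum, Finset.sum_mul, add_assoc (e 0)]
  have h1 := mul_inv_cancel₀ (zpow_ne_zero ((p : ℕ) + (m : ℕ) : ℤ) (h0 0))
  rw [show -((p : ℕ) : ℤ) - (m : ℕ) = -((p : ℕ) + (m : ℕ)) by ring, zpow_neg]
  congr 1
  · linear_combination (derivCoeff m (p : ℕ) * φ (vertexOperatorMap B u (e 0 + ((p : ℕ) + (m : ℕ)))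
      (productVec B u' (mode B (p : ℕ) a v) (Fin.tail e))) * ∏ i, z i ^ e i) * h1
  · refine Finset.sum_congr rfl fun j _ => Finset.sum_congr rfl fun q _ => ?_
    have h2 := mul_inv_cancel₀ (zpow_ne_zero ((p : ℕ) - (q : ℕ) : ℤ) (h0 j.succ))
    rw [show ((q : ℕ) : ℤ) - (p : ℕ) = -((p : ℕ) - (q : ℕ)) by ring, zpow_neg]
    set X := φ (vertexOperatorMap B u (e 0 + ((p : ℕ) + (m : ℕ)))
      (productVec B (Function.update u' j (mode B (q : ℕ) a (u' j))) v
        (Fin.tail e + Pi.single j (-((p : ℕ) - (q : ℕ)) : ℤ))))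
    linear_combination (derivCoeff m (p : ℕ) * (Nat.choose p q : ℂ) * X * ∏ i, z i ^ e i) *
      (z j.succ ^ ((p : ℕ) - (q : ℕ) : ℤ) * (z j.succ ^ ((p : ℕ) - (q : ℕ) : ℤ))⁻¹ * h1 + h2)

/-- The recursion for the products `⟨φ, Y(u₁, z₁) ⋯ Y(uₖ, zₖ)v⟩` in the first vector. -/
theorem convergesAbsolutelyTo_productTerm_letter_mul {k : ℕ} (m : ℕ+) (a : h) (u : TMinus h)
    (u' : Fin k → TMinus h) (v : TMinus h) (φ : Dual ℂ (TMinus h)) {z : Fin (k + 1) → ℂ}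
    (hz : StrictAnti fun i => ‖z i‖) (h0 : ∀ i, z i ≠ 0) (S : Finset ℕ+)
    (hS : ∀ p ∉ S, compLetter φ p a = 0 ∧ mode B (p : ℕ) a v = 0 ∧
      ∀ j, mode B (p : ℕ) a (u' j) = 0) {s₁ s₂ : ℕ+ → ℂ} {s₃ : Fin k → ℕ+ → ℂ}
    (h₁ : ∀ p, ConvergesAbsolutelyTo (productTerm (vertexOperatorMap B)
      (Fin.cons u u' : Fin (k + 1) → TMinus h) v (compLetter φ p a) z) (s₁ p))
    (h₂ : ∀ p : ℕ+, ConvergesAbsolutelyTo (productTerm (vertexOperatorMap B)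
      (Fin.cons u u' : Fin (k + 1) → TMinus h) (mode B (p : ℕ) a v) φ z) (s₂ p))
    (h₃ : ∀ (j : Fin k) (p : ℕ+), ConvergesAbsolutelyTo (productTerm (vertexOperatorMap B)
      (Fin.cons u (Function.update u' j (mode B (p : ℕ) a (u' j))) : Fin (k + 1) → TMinus h)
        v φ z) (s₃ j p)) :
    ConvergesAbsolutelyTo (productTerm (vertexOperatorMap B)
      (Fin.cons (letter m a * u) u' : Fin (k + 1) → TMinus h) v φ z)
      (∑ p ∈ S, derivCoeff m (-(p : ℕ)) * z 0 ^ ((p : ℕ) - (m : ℕ) : ℤ) * s₁ p +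
        (∑ p ∈ S, derivCoeff m (p : ℕ) * z 0 ^ (-(p : ℕ) - (m : ℕ) : ℤ) * s₂ p +
        ∑ j : Fin k, ∑ p ∈ S,
          derivCoeff m (p : ℕ) * (z 0 - z j.succ) ^ (-(m : ℕ) - (p : ℕ) : ℤ) * s₃ j p)) := by
  choose s t hs ht hst using fun e : Fin (k + 1) → ℤ =>
    exists_hasSum_vertexOperatorMap_letter_mul B φ m a u (e 0) (productVec B u' v (Fin.tail e))
  have key : ∀ e, productTerm (vertexOperatorMap B)
      (Fin.cons (letter m a * u) u' : Fin (k + 1) → TMinus h) v φ z e =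
      s e * (∏ i, z i ^ e i) + t e * ∏ i, z i ^ e i := by
    intro e
    rw [productTerm_eq, productVec_succ, Fin.cons_zero, Fin.tail_cons, hst, add_mul]
  refine ConvergesAbsolutelyTo.of_eq (.add ?_ ?_) key rfl
  · have H := ConvergesAbsolutelyTo.finite_shift
      (fun p : ℕ+ => derivCoeff m (-(p : ℕ)) * z 0 ^ ((p : ℕ) - (m : ℕ) : ℤ)) h₁
      (fun p => Pi.single 0 ((m : ℕ) - (p : ℕ) : ℤ)) S
      (fun p hp e => by rw [productTerm_eq, (hS p hp).1, LinearMap.zero_apply, zero_mul])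
    exact H.fiberwise fun e => ((hs e).mul_right (∏ i, z i ^ e i)).of_eq fun p =>
      productTerm_creation B m p a u u' v φ h0 e
  · have H₂ := ConvergesAbsolutelyTo.finite_shift
      (fun p : ℕ+ => derivCoeff m (p : ℕ) * z 0 ^ (-(p : ℕ) - (m : ℕ) : ℤ)) h₂
      (fun p => Pi.single 0 ((p : ℕ) + (m : ℕ) : ℤ)) S
      (fun p hp e => by
        rw [productTerm_eq, (hS p hp).2.1, productVec, map_zero, map_zero, zero_mul])
    -- For fixed j and p infinitely many annihilation modes q contribute. Their coefficients form
    -- the contraction series, which converges because ‖zⱼ‖ < ‖z₀‖.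
    have H₃ := fun (j : Fin k) (p : ℕ+) =>
      (convergesAbsolutelyTo_contraction m p (hz (Fin.succ_pos j))).mul_shift (h₃ j p)
        fun q => (Pi.single 0 ((q : ℕ) + (m : ℕ) : ℤ) +
            Pi.single j.succ ((p : ℕ) - (q : ℕ) : ℤ))
    have H := H₂.add (ConvergesAbsolutelyTo.sum Finset.univ fun j _ =>
      ConvergesAbsolutelyTo.sum S fun p _ => H₃ j p)
    exact H.fiberwise fun e => ((ht e).mul_right (∏ i, z i ^ e i)).of_eq fun p =>
      productTerm_annihilation B m p a u u' v φ h0 e S fun q hq => (hS q hq).2.2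

theorem productTerm_cons_one {k : ℕ} (u' : Fin k → TMinus h) (v : TMinus h)
    (φ : Dual ℂ (TMinus h)) (z : Fin (k + 1) → ℂ) (e : Fin (k + 1) → ℤ) :
    productTerm (vertexOperatorMap B) (Fin.cons 1 u' : Fin (k + 1) → TMinus h) v φ z e =
      if e 0 = 0 then productTerm (vertexOperatorMap B) u' v φ (Fin.tail z) (Fin.tail e)
      else 0 := by
  rw [productTerm_eq, productVec_succ, Fin.cons_zero, Fin.tail_cons, vertexOperatorMap_one,
    productTerm_eq, Fin.prod_univ_succ]
  split_ifs with he
  · simp [he, Fin.tail]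
  · simp

theorem convergesAbsolutelyTo_productTerm_one {k : ℕ} {u' : Fin k → TMinus h} {v : TMinus h}
    {φ : Dual ℂ (TMinus h)} {z : Fin (k + 1) → ℂ} {s : ℂ}
    (hs : ConvergesAbsolutelyTo (productTerm (vertexOperatorMap B) u' v φ (Fin.tail z)) s) :
    ConvergesAbsolutelyTo (productTerm (vertexOperatorMap B)
      (Fin.cons 1 u' : Fin (k + 1) → TMinus h) v φ z) s := by
  refine (convergesAbsolutelyTo_iff_of_injective
    (Fin.cons_right_injective (α := fun _ => ℤ) 0) fun e he => ?_).1 ?_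
  · rw [productTerm_cons_one, if_neg]
    intro h0
    exact he ⟨Fin.tail e, by rw [← h0]; exact Fin.cons_self_tail e⟩
  · refine hs.of_eq (fun e => ?_) rfl
    rw [productTerm_cons_one, Fin.cons_zero, if_pos rfl, Fin.tail_cons]

theorem productTerm_cons_add {k : ℕ} (u₁ u₂ : TMinus h) (u' : Fin k → TMinus h) (v : TMinus h)
    (φ : Dual ℂ (TMinus h)) (z : Fin (k + 1) → ℂ) (e : Fin (k + 1) → ℤ) :
    productTerm (vertexOperatorMap B) (Fin.cons (u₁ + u₂) u' : Fin (k + 1) → TMinus h) v φ z e =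
      productTerm (vertexOperatorMap B) (Fin.cons u₁ u' : Fin (k + 1) → TMinus h) v φ z e +
      productTerm (vertexOperatorMap B) (Fin.cons u₂ u' : Fin (k + 1) → TMinus h) v φ z e := by
  simp [productTerm_eq, productVec_succ, add_mul]

theorem productTerm_cons_smul {k : ℕ} (c : ℂ) (u : TMinus h) (u' : Fin k → TMinus h)
    (v : TMinus h) (φ : Dual ℂ (TMinus h)) (z : Fin (k + 1) → ℂ) (e : Fin (k + 1) → ℤ) :
    productTerm (vertexOperatorMap B) (Fin.cons (c • u) u' : Fin (k + 1) → TMinus h) v φ z e =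
      c * productTerm (vertexOperatorMap B) (Fin.cons u u' : Fin (k + 1) → TMinus h) v φ z e := by
  simp [productTerm_eq, productVec_succ, mul_assoc]

theorem isRational_recursion {k : ℕ} (m : ℕ+) (S : Finset ℕ+)
    {F₁ F₂ : ℕ+ → (Fin (k + 1) → ℂ) → ℂ} {F₃ : Fin k → ℕ+ → (Fin (k + 1) → ℂ) → ℂ}
    (h₁ : ∀ p, IsRational (F₁ p)) (h₂ : ∀ p, IsRational (F₂ p)) (h₃ : ∀ j p, IsRational (F₃ j p)) :
    IsRational fun z =>
      ∑ p ∈ S, derivCoeff m (-(p : ℕ)) * z 0 ^ ((p : ℕ) - (m : ℕ) : ℤ) * F₁ p z +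
        (∑ p ∈ S, derivCoeff m (p : ℕ) * z 0 ^ (-(p : ℕ) - (m : ℕ) : ℤ) * F₂ p z +
        ∑ j : Fin k, ∑ p ∈ S,
          derivCoeff m (p : ℕ) * (z 0 - z j.succ) ^ (-(m : ℕ) - (p : ℕ) : ℤ) * F₃ j p z) :=
  (IsRational.sum S fun p _ => ((isRational_zpow 0 _).const_mul _).mul (h₁ p)).add
    ((IsRational.sum S fun p _ => ((isRational_zpow 0 _).const_mul _).mul (h₂ p)).add
      (IsRational.sum _ fun j _ => IsRational.sum S fun p _ =>
        ((isRational_sub_zpow (Fin.succ_pos j) _).const_mul _).mul (h₃ j p)))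

/-- Outer induction on the number of fields, inner induction on the first vector. The recursion
shortens only the first vector and alters the other data, to φ ∘ a(-p), a(p)v and a(p)uⱼ, so the
inner hypothesis must hold for all of these at once. -/
theorem exists_isRational_product {k : ℕ} (u : Fin k → TMinus h) (v : TMinus h)
    {φ : Dual ℂ (TMinus h)} (hφ : VanishesAbove φ) :
    ∃ F : (Fin k → ℂ) → ℂ, IsRational F ∧ ∀ z : Fin k → ℂ,
      StrictAnti (fun i => ‖z i‖) → (∀ i, z i ≠ 0) →
      ConvergesAbsolutelyTo (productTerm (vertexOperatorMap B) u v φ z) (F z) := by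
  induction k generalizing v φ with
  | zero =>
    refine ⟨fun _ => φ v, isRational_const _, fun z _ _ => ?_⟩
    refine ConvergesAbsolutelyTo.of_eq (f := fun _ => φ v) ?_ (fun e => by
      simp [productTerm]) rfl
    exact ⟨(hasSum_unique _).summable, hasSum_unique _⟩
  | succ k ih =>
    obtain ⟨u₀, u', rfl⟩ : ∃ (u₀ : TMinus h) (u' : Fin k → TMinus h), u = Fin.cons u₀ u' :=
      ⟨u 0, Fin.tail u, (Fin.cons_self_tail u).symm⟩
    induction u₀ using TMinus.induction generalizing u' v φ with
    | one =>
      obtain ⟨F, hF, hconv⟩ := ih u' v hφ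
      refine ⟨_, hF.comp_tail, fun z hz h0 => convergesAbsolutelyTo_productTerm_one B
        (hconv _ (fun i j hij => hz (Fin.succ_lt_succ_iff.2 hij)) fun i => h0 _)⟩
    | add u₁ u₂ h₁ h₂ =>
      obtain ⟨F₁, hF₁, hc₁⟩ := h₁ v hφ u'
      obtain ⟨F₂, hF₂, hc₂⟩ := h₂ v hφ u'
      exact ⟨_, hF₁.add hF₂, fun z hz h0 => ((hc₁ z hz h0).add (hc₂ z hz h0)).of_eq
        (productTerm_cons_add B u₁ u₂ u' v φ z) rfl⟩
    | smul c u₁ h₁ =>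
      obtain ⟨F₁, hF₁, hc₁⟩ := h₁ v hφ u'
      exact ⟨_, hF₁.const_mul c, fun z hz h0 => ((hc₁ z hz h0).const_mul c).of_eq
        (productTerm_cons_smul B c u₁ u' v φ z) rfl⟩
    | letter_mul m a u₁ h₁ =>
      obtain ⟨S, hS⟩ := hφ.exists_finset B v u' a
      choose F₁ hF₁ hc₁ using fun p : ℕ+ => h₁ v (hφ.compLetter p a) u'
      choose F₂ hF₂ hc₂ using fun p : ℕ+ => h₁ (mode B (p : ℕ) a v) hφ u'
      choose F₃ hF₃ hc₃ using fun (j : Fin k) (p : ℕ+) =>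
        h₁ v hφ (Function.update u' j (mode B (p : ℕ) a (u' j)))
      exact ⟨_, isRational_recursion m S hF₁ hF₂ hF₃, fun z hz h0 =>
        convergesAbsolutelyTo_productTerm_letter_mul B m a u₁ u' v φ hz h0 S hS
          (fun p => hc₁ p z hz h0) (fun p => hc₂ p z hz h0) fun j p => hc₃ j p z hz h0⟩

end Product

/-! ### Iterates of vertex operators and associativity -/

section Iterate

variable (B : LinearMap.BilinForm ℂ h)

theorem ConvergesAbsolutelyTo.finite_mul_shift {ι κ E : Type*} [AddGroup E] {k : κ → ι → ℂ}
    {f : κ → E → ℂ} {c s : κ → ℂ} (hk : ∀ q, ConvergesAbsolutelyTo (k q) (c q))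
    (hf : ∀ q, ConvergesAbsolutelyTo (f q) (s q)) (d : κ → ι → E) (S : Finset κ)
    (h0 : ∀ q ∉ S, ∀ e, f q e = 0) :
    ConvergesAbsolutelyTo (fun r : κ × (ι × E) => k r.1 r.2.1 * f r.1 (r.2.2 + d r.1 r.2.1))
      (∑ q ∈ S, c q * s q) := by
  refine convergesAbsolutelyTo_of_finite
    (H := fun r : κ × (ι × E) => k r.1 r.2.1 * f r.1 (r.2.2 + d r.1 r.2.1))
    (s := fun q => c q * s q) S (fun q hq r => ?_) fun q _ => ?_
  · simp only [h0 q hq, mul_zero]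
  · exact (hk q).mul_shift (hf q) (d q)

/-- The functional `u ↦ ⟨φ, Y(u, x)v⟩`, coefficient of `x ^ N`. -/
noncomputable def vertexFunctional (φ : Dual ℂ (TMinus h)) (N : ℤ) (v : TMinus h) :
    Dual ℂ (TMinus h) :=
  φ ∘ₗ LinearMap.applyₗ v ∘ₗ LinearMap.proj N ∘ₗ vertexOperatorMap B

theorem vertexFunctional_apply (φ : Dual ℂ (TMinus h)) (N : ℤ) (u v : TMinus h) :
    vertexFunctional B φ N v u = φ (vertexOperatorMap B u N v) := rfl

theorem iterateTerm_shift (u₁ u₂ v : TMinus h) (φ : Dual ℂ (TMinus h)) {z₁ z₂ : ℂ}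
    (hx : z₁ - z₂ ≠ 0) (hz : z₂ ≠ 0) (e : ℤ × ℤ) (c d : ℤ) :
    iterateTerm (vertexOperatorMap B) u₁ u₂ v φ z₁ z₂ (e + (c, d)) =
      φ (vertexOperatorMap B (vertexOperatorMap B u₁ (e.1 + c) u₂) (e.2 + d) v) *
        ((z₁ - z₂) ^ e.1 * z₂ ^ e.2) * ((z₁ - z₂) ^ c * z₂ ^ d) := by
  simp only [iterateTerm, Prod.fst_add, Prod.snd_add, zpow_add₀ hx, zpow_add₀ hz]
  ring

theorem iterateTerm_creation_creation (m p q : ℕ+) (a : h) (u₁ u₂ v : TMinus h)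
    (φ : Dual ℂ (TMinus h)) {z₁ z₂ : ℂ} (hx : z₁ - z₂ ≠ 0) (hz : z₂ ≠ 0) (e : ℤ × ℤ) :
    derivCoeff m (-(p : ℕ)) * derivCoeff p (-(q : ℕ)) * (z₁ - z₂) ^ ((p : ℕ) - (m : ℕ) : ℤ) *
        z₂ ^ (-(-(q : ℕ)) - (p : ℕ) : ℤ) *
      iterateTerm (vertexOperatorMap B) u₁ u₂ v (compLetter φ q a) z₁ z₂
        (e + (((m : ℕ) - (p : ℕ) : ℤ), ((p : ℕ) - (q : ℕ) : ℤ))) =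
    derivCoeff m (-(p : ℕ)) * ((z₁ - z₂) ^ e.1 * z₂ ^ e.2) * (derivCoeff p (-(q : ℕ)) *
      φ (letter q a * vertexOperatorMap B (vertexOperatorMap B u₁ (e.1 - (p : ℕ) + (m : ℕ)) u₂)
        (e.2 - (q : ℕ) + (p : ℕ)) v)) := by
  rw [iterateTerm_shift B u₁ u₂ v _ hx hz, compLetter_apply,
    show e.1 + (((m : ℕ) : ℤ) - (p : ℕ)) = e.1 - (p : ℕ) + (m : ℕ) by ring,
    show e.2 + (((p : ℕ) : ℤ) - (q : ℕ)) = e.2 - (q : ℕ) + (p : ℕ) by ring,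
    show ((m : ℕ) : ℤ) - (p : ℕ) = -((p : ℕ) - (m : ℕ)) by ring,
    show (-(-((q : ℕ) : ℤ)) - (p : ℕ)) = -((p : ℕ) - (q : ℕ)) by ring, zpow_neg, zpow_neg]
  have h1 := mul_inv_cancel₀ (zpow_ne_zero ((p : ℕ) - (m : ℕ) : ℤ) hx)
  have h2 := mul_inv_cancel₀ (zpow_ne_zero ((p : ℕ) - (q : ℕ) : ℤ) hz)
  set X := φ (letter q a * vertexOperatorMap B (vertexOperatorMap B u₁ (e.1 - (p : ℕ) + (m : ℕ))
    u₂) (e.2 - (q : ℕ) + (p : ℕ)) v)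
  linear_combination (derivCoeff m (-(p : ℕ)) * derivCoeff p (-(q : ℕ)) * X *
    ((z₁ - z₂) ^ e.1 * z₂ ^ e.2)) *
    (z₂ ^ ((p : ℕ) - (q : ℕ) : ℤ) * (z₂ ^ ((p : ℕ) - (q : ℕ) : ℤ))⁻¹ * h1 + h2)

theorem iterateTerm_creation_annihilation (m p q : ℕ+) (a : h) (u₁ u₂ v : TMinus h)
    (φ : Dual ℂ (TMinus h)) {z₁ z₂ : ℂ} (hx : z₁ - z₂ ≠ 0) (hz : z₂ ≠ 0) (e : ℤ × ℤ) :
    derivCoeff m (-(p : ℕ)) * derivCoeff p (q : ℕ) * (z₁ - z₂) ^ ((p : ℕ) - (m : ℕ) : ℤ) *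
        z₂ ^ (-(q : ℕ) - (p : ℕ) : ℤ) *
      iterateTerm (vertexOperatorMap B) u₁ u₂ (mode B (q : ℕ) a v) φ z₁ z₂
        (e + (((m : ℕ) - (p : ℕ) : ℤ), ((q : ℕ) + (p : ℕ) : ℤ))) =
    derivCoeff m (-(p : ℕ)) * ((z₁ - z₂) ^ e.1 * z₂ ^ e.2) * (derivCoeff p (q : ℕ) *
      φ (vertexOperatorMap B (vertexOperatorMap B u₁ (e.1 - (p : ℕ) + (m : ℕ)) u₂)
        (e.2 + (q : ℕ) + (p : ℕ)) (mode B (q : ℕ) a v))) := by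
  rw [iterateTerm_shift B u₁ u₂ _ _ hx hz, ← add_assoc e.2,
    show e.1 + (((m : ℕ) : ℤ) - (p : ℕ)) = e.1 - (p : ℕ) + (m : ℕ) by ring,
    show ((m : ℕ) : ℤ) - (p : ℕ) = -((p : ℕ) - (m : ℕ)) by ring,
    show (-((q : ℕ) : ℤ) - (p : ℕ)) = -((q : ℕ) + (p : ℕ)) by ring, zpow_neg, zpow_neg]
  have h1 := mul_inv_cancel₀ (zpow_ne_zero ((p : ℕ) - (m : ℕ) : ℤ) hx)
  have h2 := mul_inv_cancel₀ (zpow_ne_zero ((q : ℕ) + (p : ℕ) : ℤ) hz)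
  set X := φ (vertexOperatorMap B (vertexOperatorMap B u₁ (e.1 - (p : ℕ) + (m : ℕ)) u₂)
        (e.2 + (q : ℕ) + (p : ℕ)) (mode B (q : ℕ) a v))
  linear_combination (derivCoeff m (-(p : ℕ)) * derivCoeff p (q : ℕ) * X *
    ((z₁ - z₂) ^ e.1 * z₂ ^ e.2)) *
    (z₂ ^ ((q : ℕ) + (p : ℕ) : ℤ) * (z₂ ^ ((q : ℕ) + (p : ℕ) : ℤ))⁻¹ * h1 + h2)

theorem iterateTerm_annihilation (m p : ℕ+) (a : h) (u₁ u₂ v : TMinus h)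
    (φ : Dual ℂ (TMinus h)) {z₁ z₂ : ℂ} (hx : z₁ - z₂ ≠ 0) (hz : z₂ ≠ 0) (e : ℤ × ℤ) :
    derivCoeff m (p : ℕ) * (z₁ - z₂) ^ (-(m : ℕ) - (p : ℕ) : ℤ) *
      iterateTerm (vertexOperatorMap B) u₁ (mode B (p : ℕ) a u₂) v φ z₁ z₂
        (e + (((p : ℕ) + (m : ℕ) : ℤ), (0 : ℤ))) =
    derivCoeff m (p : ℕ) * φ (vertexOperatorMap B (vertexOperatorMap B u₁
      (e.1 + (p : ℕ) + (m : ℕ)) (mode B (p : ℕ) a u₂)) e.2 v) *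
        ((z₁ - z₂) ^ e.1 * z₂ ^ e.2) := by
  rw [iterateTerm_shift B u₁ _ v _ hx hz, ← add_assoc e.1, add_zero,
    show (-((m : ℕ) : ℤ) - (p : ℕ)) = -((p : ℕ) + (m : ℕ)) by ring, zpow_neg, zpow_zero]
  have h1 := mul_inv_cancel₀ (zpow_ne_zero ((p : ℕ) + (m : ℕ) : ℤ) hx)
  linear_combination (derivCoeff m (p : ℕ) * φ (vertexOperatorMap B (vertexOperatorMap B u₁
      (e.1 + (p : ℕ) + (m : ℕ)) (mode B (p : ℕ) a u₂)) e.2 v) *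
        ((z₁ - z₂) ^ e.1 * z₂ ^ e.2)) * h1

/-- The recursion for the iterates `⟨φ, Y(Y(u₁, z₁ - z₂)u₂, z₂)v⟩` in the first vector. -/
theorem convergesAbsolutelyTo_iterateTerm_letter_mul (m : ℕ+) (a : h) (u₁ u₂ v : TMinus h)
    (φ : Dual ℂ (TMinus h)) {z₁ z₂ : ℂ} (h0 : 0 < ‖z₁ - z₂‖) (hz : ‖z₁ - z₂‖ < ‖z₂‖)
    (S : Finset ℕ+) (hS : ∀ p ∉ S, compLetter φ p a = 0 ∧ mode B (p : ℕ) a v = 0 ∧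
      mode B (p : ℕ) a u₂ = 0) {s₁ s₂ s₃ : ℕ+ → ℂ}
    (h₁ : ∀ p, ConvergesAbsolutelyTo (iterateTerm (vertexOperatorMap B) u₁ u₂ v
      (compLetter φ p a) z₁ z₂) (s₁ p))
    (h₂ : ∀ p : ℕ+, ConvergesAbsolutelyTo (iterateTerm (vertexOperatorMap B) u₁ u₂
      (mode B (p : ℕ) a v) φ z₁ z₂) (s₂ p))
    (h₃ : ∀ p : ℕ+, ConvergesAbsolutelyTo (iterateTerm (vertexOperatorMap B) u₁
      (mode B (p : ℕ) a u₂) v φ z₁ z₂) (s₃ p)) :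
    ConvergesAbsolutelyTo (iterateTerm (vertexOperatorMap B) (letter m a * u₁) u₂ v φ z₁ z₂)
      (∑ p ∈ S, derivCoeff m (-(p : ℕ)) * z₁ ^ ((p : ℕ) - (m : ℕ) : ℤ) * s₁ p +
        (∑ p ∈ S, derivCoeff m (p : ℕ) * z₁ ^ (-(p : ℕ) - (m : ℕ) : ℤ) * s₂ p +
        ∑ p ∈ S, derivCoeff m (p : ℕ) * (z₁ - z₂) ^ (-(m : ℕ) - (p : ℕ) : ℤ) * s₃ p)) := by
  have hx : z₁ - z₂ ≠ 0 := norm_pos_iff.1 h0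
  have hz₂ : z₂ ≠ 0 := norm_pos_iff.1 (h0.trans hz)
  choose s t hs ht hst using fun e : ℤ × ℤ =>
    exists_hasSum_vertexOperatorMap_letter_mul B (vertexFunctional B φ e.2 v) m a u₁ e.1 u₂
  -- The creation part of the inner operator produces vectors a(-p)w; the recursion is applied again
  -- to their outer vertex operators, with r.1 = p.
  choose s' t' hs' ht' hst' using fun r : ℕ+ × (ℤ × ℤ) =>
    exists_hasSum_vertexOperatorMap_letter_mul B φ r.1 a
      (vertexOperatorMap B u₁ (r.2.1 - (r.1 : ℕ) + (m : ℕ)) u₂) r.2.2 v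
  have key : ∀ e, iterateTerm (vertexOperatorMap B) (letter m a * u₁) u₂ v φ z₁ z₂ e =
      s e * ((z₁ - z₂) ^ e.1 * z₂ ^ e.2) + t e * ((z₁ - z₂) ^ e.1 * z₂ ^ e.2) := by
    intro e
    rw [← add_mul, ← hst, vertexFunctional_apply, iterateTerm, mul_assoc]
  rw [← add_assoc]
  refine ConvergesAbsolutelyTo.of_eq (.add ?_ ?_) key rfl
  · have H₁ : ConvergesAbsolutelyTo (fun r : ℕ+ × (ℤ × ℤ) =>
        derivCoeff m (-(r.1 : ℕ)) * ((z₁ - z₂) ^ r.2.1 * z₂ ^ r.2.2) * s' r)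
        (∑ q ∈ S, derivCoeff m (-(q : ℕ)) * z₁ ^ ((q : ℕ) - (m : ℕ) : ℤ) * s₁ q) := by
      have H := ConvergesAbsolutelyTo.finite_mul_shift
        (fun q : ℕ+ => convergesAbsolutelyTo_taylor m (-(q : ℕ)) hz) h₁
        (fun q p => (((m : ℕ) - (p : ℕ) : ℤ), ((p : ℕ) - (q : ℕ) : ℤ))) S
        (fun q hq e => by rw [iterateTerm, (hS q hq).1, LinearMap.zero_apply, zero_mul, zero_mul])
      refine (H.fiberwise fun r => ((hs' r).mul_left _).of_eq fun q =>
        iterateTerm_creation_creation B m r.1 q a u₁ u₂ v φ hx hz₂ r.2).of_eq (fun _ => rfl) ?_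
      simp only [add_sub_cancel, neg_neg]
    have H₂ : ConvergesAbsolutelyTo (fun r : ℕ+ × (ℤ × ℤ) =>
        derivCoeff m (-(r.1 : ℕ)) * ((z₁ - z₂) ^ r.2.1 * z₂ ^ r.2.2) * t' r)
        (∑ q ∈ S, derivCoeff m (q : ℕ) * z₁ ^ (-(q : ℕ) - (m : ℕ) : ℤ) * s₂ q) := by
      have H := ConvergesAbsolutelyTo.finite_mul_shift
        (fun q : ℕ+ => convergesAbsolutelyTo_taylor m (q : ℕ) hz) h₂
        (fun q p => (((m : ℕ) - (p : ℕ) : ℤ), ((q : ℕ) + (p : ℕ) : ℤ))) S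
        (fun q hq e => by rw [iterateTerm, (hS q hq).2.1, map_zero, map_zero, zero_mul, zero_mul])
      refine (H.fiberwise fun r => ((ht' r).mul_left _).of_eq fun q =>
        iterateTerm_creation_annihilation B m r.1 q a u₁ u₂ v φ hx hz₂ r.2).of_eq
          (fun _ => rfl) ?_
      simp only [add_sub_cancel]
    refine (H₁.add H₂).fiberwise fun e =>
      ((hs e).mul_right ((z₁ - z₂) ^ e.1 * z₂ ^ e.2)).of_eq fun p => ?_
    rw [vertexFunctional_apply, hst' (p, e)]
    ring
  -- The inner annihilation part acts directly on u₂ and already carries the power of z₁ - z₂ that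
  -- the contraction gives in the product.
  · have H := ConvergesAbsolutelyTo.finite_shift
      (fun p : ℕ+ => derivCoeff m (p : ℕ) * (z₁ - z₂) ^ (-(m : ℕ) - (p : ℕ) : ℤ)) h₃
      (fun p => (((p : ℕ) + (m : ℕ) : ℤ), (0 : ℤ))) S
      (fun p hp e => by simp [iterateTerm, (hS p hp).2.2])
    exact H.fiberwise fun e =>
      ((ht e).mul_right ((z₁ - z₂) ^ e.1 * z₂ ^ e.2)).of_eq fun p =>
        iterateTerm_annihilation B m p a u₁ u₂ v φ hx hz₂ e

theorem convergesAbsolutelyTo_iterateTerm_one {u₂ v : TMinus h} {φ : Dual ℂ (TMinus h)}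
    {z₁ z₂ s : ℂ}
    (hs : ConvergesAbsolutelyTo (productTerm (vertexOperatorMap B) ![u₂] v φ ![z₂]) s) :
    ConvergesAbsolutelyTo (iterateTerm (vertexOperatorMap B) 1 u₂ v φ z₁ z₂) s := by
  refine (convergesAbsolutelyTo_iff_of_injective (Prod.mk_right_injective (0 : ℤ))
    fun e he => ?_).1 ?_
  · have : e.1 ≠ 0 := fun h0 => he ⟨e.2, by rw [← h0]⟩
    simp [iterateTerm, vertexOperatorMap_one, this]
  · refine (hs.comp_equiv (Equiv.funUnique (Fin 1) ℤ).symm).of_eq (fun e => ?_) rfl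
    simp [iterateTerm, vertexOperatorMap_one, productTerm]

/-- Product and iterate obey the same recursion in u₁ and agree for u₁ = 𝟏, where both reduce to ⟨φ,
Y(u₂, z₂)v⟩. A simultaneous induction therefore yields a common F. -/
theorem exists_isRational_product_iterate (u₁ u₂ v : TMinus h) {φ : Dual ℂ (TMinus h)}
    (hφ : VanishesAbove φ) :
    ∃ F : (Fin 2 → ℂ) → ℂ, IsRational F ∧ ∀ z₁ z₂ : ℂ,
      (‖z₂‖ < ‖z₁‖ → 0 < ‖z₂‖ →
        ConvergesAbsolutelyTo (productTerm (vertexOperatorMap B) ![u₁, u₂] v φ ![z₁, z₂])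
          (F ![z₁, z₂])) ∧
      (0 < ‖z₁ - z₂‖ → ‖z₁ - z₂‖ < ‖z₂‖ →
        ConvergesAbsolutelyTo (iterateTerm (vertexOperatorMap B) u₁ u₂ v φ z₁ z₂)
          (F ![z₁, z₂])) := by
  induction u₁ using TMinus.induction generalizing u₂ v φ with
  | one =>
    obtain ⟨F, hF, hc⟩ := exists_isRational_product B ![u₂] v hφ
    have hc' : ∀ z₂ : ℂ, 0 < ‖z₂‖ → ConvergesAbsolutelyTo
        (productTerm (vertexOperatorMap B) ![u₂] v φ ![z₂]) (F ![z₂]) := fun z₂ h0 =>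
      hc _ (Subsingleton.strictAnti _) fun i => by simpa using h0
    exact ⟨_, hF.comp_tail, fun z₁ z₂ =>
      ⟨fun _ h0 => convergesAbsolutelyTo_productTerm_one B (hc' z₂ h0),
        fun h0 h1 => convergesAbsolutelyTo_iterateTerm_one B (hc' z₂ (h0.trans h1))⟩⟩
  | add u u' hu hu' =>
    obtain ⟨F, hF, hc⟩ := hu u₂ v hφ
    obtain ⟨F', hF', hc'⟩ := hu' u₂ v hφ
    refine ⟨_, hF.add hF', fun z₁ z₂ => ⟨fun h0 h1 => ?_, fun h0 h1 => ?_⟩⟩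
    · exact (((hc z₁ z₂).1 h0 h1).add ((hc' z₁ z₂).1 h0 h1)).of_eq
        (productTerm_cons_add B u u' ![u₂] v φ _) rfl
    · refine (((hc z₁ z₂).2 h0 h1).add ((hc' z₁ z₂).2 h0 h1)).of_eq (fun e => ?_) rfl
      simp [iterateTerm, add_mul]
  | smul c u hu =>
    obtain ⟨F, hF, hc⟩ := hu u₂ v hφ
    refine ⟨_, hF.const_mul c, fun z₁ z₂ => ⟨fun h0 h1 => ?_, fun h0 h1 => ?_⟩⟩
    · exact (((hc z₁ z₂).1 h0 h1).const_mul c).of_eq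
        (productTerm_cons_smul B c u ![u₂] v φ _) rfl
    · refine (((hc z₁ z₂).2 h0 h1).const_mul c).of_eq (fun e => ?_) rfl
      simp [iterateTerm, mul_assoc]
  | letter_mul m a u hu =>
    obtain ⟨S, hS⟩ := hφ.exists_finset B v ![u₂] a
    choose F₁ hF₁ hc₁ using fun p : ℕ+ => hu u₂ v (hφ.compLetter p a)
    choose F₂ hF₂ hc₂ using fun p : ℕ+ => hu u₂ (mode B (p : ℕ) a v) hφ
    choose F₃ hF₃ hc₃ using fun p : ℕ+ => hu (mode B (p : ℕ) a u₂) v hφ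
    have hupd : ∀ (j : Fin 1) (p : ℕ+),
        Function.update ![u₂] j (mode B (p : ℕ) a (![u₂] j)) = ![mode B (p : ℕ) a u₂] := by
      intro j p
      obtain rfl := Subsingleton.elim j 0
      ext i
      obtain rfl := Subsingleton.elim i 0
      simp
    -- The witness is the product recursion with one remaining field; the iterate recursion is the
    -- same expression once the sum over `Fin 1` is collapsed.
    refine ⟨_, isRational_recursion m S hF₁ hF₂ fun (_ : Fin 1) p => hF₃ p,
      fun z₁ z₂ => ⟨fun h0 h1 => ?_, fun h0 h1 => ?_⟩⟩
    · refine convergesAbsolutelyTo_productTerm_letter_mul B m a u ![u₂] v φ ?_ ?_ S hS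
        (fun p => (hc₁ p z₁ z₂).1 h0 h1) (fun p => (hc₂ p z₁ z₂).1 h0 h1) fun j p => ?_
      · refine Fin.strictAnti_iff_succ_lt.2 fun i => ?_
        obtain rfl := Subsingleton.elim i 0
        exact h0
      · intro i
        fin_cases i
        · exact norm_pos_iff.1 (h1.trans h0)
        · exact norm_pos_iff.1 h1
      · rw [hupd]
        exact (hc₃ p z₁ z₂).1 h0 h1
    · refine (convergesAbsolutelyTo_iterateTerm_letter_mul B m a u u₂ v φ h0 h1 S
        (fun p hp => ⟨(hS p hp).1, (hS p hp).2.1, (hS p hp).2.2 0⟩)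
        (fun p => (hc₁ p z₁ z₂).2 h0 h1) (fun p => (hc₂ p z₁ z₂).2 h0 h1)
        fun p => (hc₃ p z₁ z₂).2 h0 h1).of_eq (fun _ => rfl) ?_
      simp

theorem poleDenom_two (z₁ z₂ : ℂ) : poleDenom ![z₁, z₂] = z₁ * z₂ * (z₁ - z₂) := by
  have h0 : Finset.Ioi (0 : Fin 2) = {1} := by decide
  have h1 : Finset.Ioi (1 : Fin 2) = ∅ := by decide
  simp [poleDenom, Fin.prod_univ_two, h0, h1]

end Iterate

/-! ### Verification of the axioms -/

theorem isMeromorphicOpenStringVertexAlgebra (B : LinearMap.BilinForm ℂ h) :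
    IsMeromorphicOpenStringVertexAlgebra (weightSpace h) (vertexOperatorMap B)
      (1 : TMinus h) where
  isInternal := isInternal_weightSpace
  lower_bound := ⟨0, fun _ hn => weightSpace_neg hn⟩
  identity := vertexOperatorMap_one B
  creation_regular u _ hn := vertexOperatorMap_neg_one B u hn
  creation := vertexOperatorMap_zero_one B
  rationality_product k u v φ hφ := by
    obtain ⟨F, ⟨p, N, hp⟩, hc⟩ := exists_isRational_product B u v hφ.vanishesAbove
    exact ⟨p, N, fun z hz h0 =>
      (hc z hz h0).of_eq (fun _ => rfl) (hp z (poleDenom_ne_zero hz h0)).symm⟩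
  rationality_iterate u₁ u₂ v φ hφ := by
    obtain ⟨F, ⟨p, N, hp⟩, hc⟩ := exists_isRational_product_iterate B u₁ u₂ v hφ.vanishesAbove
    refine ⟨p, N, fun z₁ z₂ h0 h1 => ((hc z₁ z₂).2 h0 h1).of_eq (fun _ => rfl) ?_⟩
    rw [← poleDenom_two]
    refine (hp _ ?_).symm
    -- If z₁ = 0 then ‖z₁ - z₂‖ = ‖z₂‖, which the domain of the iterate excludes.
    have hz₁ : z₁ ≠ 0 := by
      rintro rfl
      simp at h1
    rw [poleDenom_two]
    exact mul_ne_zero (mul_ne_zero hz₁ (norm_pos_iff.1 (h0.trans h1))) (norm_pos_iff.1 h0)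
  associativity u₁ u₂ v φ hφ z₁ z₂ h0 h1 h2 := by
    obtain ⟨F, -, hc⟩ := exists_isRational_product_iterate B u₁ u₂ v hφ.vanishesAbove
    exact ⟨_, (hc z₁ z₂).1 h0 (h2.trans h1), (hc z₁ z₂).2 h2 h1⟩
  d_bracket u n := by
    refine LinearMap.ext fun v => ?_
    rw [Ring.lie_def, LinearMap.sub_apply, End.mul_apply, End.mul_apply,
      gradingOperator_vertexOperatorMap, LinearMap.add_apply, FormalDist.xDeriv,
      LinearMap.smul_apply, Int.cast_smul_eq_zsmul]
    abel
  D_derivative u := by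
    refine funext fun n => LinearMap.ext fun v => ?_
    rw [translationOperator_eq, ← deriv_vertexOperatorMap, FormalDist.deriv,
      LinearMap.smul_apply, ← Int.cast_smul_eq_zsmul ℂ]
    push_cast
    rfl
  D_commutator u n v := by
    rw [translationOperator_eq, translationOperator_eq, ← translation_vertexOperatorMap,
      FormalDist.deriv, LinearMap.smul_apply, ← Int.cast_smul_eq_zsmul ℂ]
    push_cast
    rfl

end Mosva

theorem theorem5p1 {h : Type*} [AddCommGroup h] [Module ℂ h]
    (B : LinearMap.BilinForm ℂ h) (hB : B.Nondegenerate) :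
    Mosva.IsMeromorphicOpenStringVertexAlgebra (Mosva.weightSpace h) (Mosva.vertexOperatorMap B)
      (1 : Mosva.TMinus h) ∧
    (FiniteDimensional ℂ h → Mosva.IsGradingRestricted (Mosva.weightSpace h)) :=
  ⟨Mosva.isMeromorphicOpenStringVertexAlgebra B, fun _ n =>
    Mosva.finiteDimensional_weightSpace n⟩
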